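/- **Theorem 5.2.** Let $a<b$, $\Omega=(a,b)$, $0<\alpha<1$, $0<\sigma<1$, $r>0$, and $\mathcal L v(x)=\int_a^b \frac{v(y)-v(x)}{|x-y|^{\alpha}}\,dy$. Let $u$ solve $$u_t(x,t)-\mathcal L u(x,t)=f(x,t)\ \ (x\in\Omega,\ 0<t<1),\qquad u(x,0)=u_0(x)\ \ (x\in\Omega),\qquad u(x,t)=0\ \ (x\in\mathbb R\setminus\Omega,\ 0\le t\le 1).$$ Assume that $u(\cdot,t)\in C^2(\Omega)$ for every $t\in[0,1]$ and that, with a constant $K$, $$\left|\partial_x^{\ell}u(x,t)\right|\le K\,[(x-a)(b-x)]^{\sigma-\ell}\qquad(\ell=0,1,2,\ x\in\Omega,\ 0\le t\le 1),$$ and that $u(x,\cdot)\in C^3([0,1])$ for every $x\in\Omega$, with $\partial_t^3u$ bounded on $\Omega\times[0,1]$. For an integer $N\ge 1$ let $x_j=a+\frac{b-a}{2}\left(\frac jN\right)^r$ for $0\le j\le N$ and $x_j=b-\frac{b-a}{2}\left(2-\frac jN\right)^r$ for $N<j\le 2N$. Let $\phi_1,\dots,\phi_{2N-1}$ be the piecewise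 linear hat functions of this mesh at its interior nodes, and let $A=(a_{i,k})_{1\le i,k\le 2N-1}$ with $a_{i,k}=\int_a^b\frac{\phi_k(x_i)-\phi_k(y)}{|x_i-y|^{\alpha}}\,dy$. For an integer $M\ge 1$ let $\tau=1/M$ and $t_s=s\tau$, and let $U^k=(u_1^k,\dots,u_{2N-1}^k)^T$, $0\le k\le M$, be computed by the collocation Crank–Nicolson scheme $$u_i^0=u_0(x_i),\qquad \left(I+\tfrac{\tau}{2}A\right)U^{k}=\left(I-\tfrac{\tau}{2}A\right)U^{k-1}+\tau F^{k-\frac12}\quad(1\le k\le M),$$ where $F^{k-\frac12}=\big(f(x_1,t_{k-\frac12}),\dots,f(x_{2N-1},t_{k-\frac12})\big)^T$. Then there is a constant $C>0$, independent of $N$ and $M$, such that for all $N\ge1$ (with $N\ge2$ in the second case) and all $M\ge1$ $$\max_{\substack{1\le i\le 2N-1\\ 1\le k\le M}}|u(x_i,t_k)-u_i^k|\le \begin{cases} C\left(N^{-r(1+\sigma-\alpha)}+M^{-2}\right), & r(1+\sigma-\alpha)<2,\\ C\left(N^{-r(1+\sigma-\alpha)}\ln N+M^{-2}\right), & r(1+\sigma-\alpha)=2,\\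 C\left(N^{-2}+M^{-2}\right), & r(1+\sigma-\alpha)>2. \end{cases}$$ -/

import Mathlib

namespace NonlocalCN

open Set

noncomputable section

/-- The nonlocal operator `𝓛 v (x) = ∫_a^b (v(y) - v(x)) / |x - y|^α dy` on `Ω = (a, b)`. -/
def nonlocalOp (a b α : ℝ) (v : ℝ → ℝ) (x : ℝ) : ℝ :=
  ∫ y in a..b, (v y - v x) / |x - y| ^ α

/-- `u` solves `u_t - 𝓛 u = f` in `(a, b) × (0, 1)`, with initial value `u₀` and with `u = 0`
outside `(a, b)`. -/
structure IsSolution (a b α : ℝ) (u₀ : ℝ → ℝ) (f u : ℝ → ℝ → ℝ) : Prop where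
  equation : ∀ x ∈ Ioo a b, ∀ t ∈ Ioo (0 : ℝ) 1,
    HasDerivAt (fun s => u x s) (nonlocalOp a b α (fun y => u y t) x + f x t) t
  initial : ∀ x ∈ Ioo a b, u x 0 = u₀ x
  exterior : ∀ x ∉ Ioo a b, ∀ t ∈ Icc (0 : ℝ) 1, u x t = 0

/-- Low regularity in space, uniformly in time: `u(·, t)` is `C²` in `(a, b)` and
`|∂_x^ℓ u(x, t)| ≤ K [(x - a)(b - x)]^(σ - ℓ)` for `ℓ = 0, 1, 2`. -/
def SpaceRegular (a b σ : ℝ) (u : ℝ → ℝ → ℝ) : Prop :=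
  (∀ t ∈ Icc (0 : ℝ) 1, ContDiffOn ℝ 2 (fun x => u x t) (Ioo a b)) ∧
  ∃ K : ℝ, ∀ ℓ : ℕ, ℓ ≤ 2 → ∀ t ∈ Icc (0 : ℝ) 1, ∀ x ∈ Ioo a b,
    |iteratedDeriv ℓ (fun y => u y t) x| ≤ K * ((x - a) * (b - x)) ^ (σ - (ℓ : ℝ))

/-- Smoothness in time: each `u(x, ·)` is `C³` on `[0, 1]`, and `∂_t³ u` is bounded on
`(a, b) × [0, 1]`. -/
def TimeRegular (a b : ℝ) (u : ℝ → ℝ → ℝ) : Prop :=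
  (∀ x ∈ Ioo a b, ContDiffOn ℝ 3 (fun t => u x t) (Icc (0 : ℝ) 1)) ∧
  ∃ K : ℝ, ∀ x ∈ Ioo a b, ∀ t ∈ Icc (0 : ℝ) 1,
    |iteratedDerivWithin 3 (fun s => u x s) (Icc (0 : ℝ) 1) t| ≤ K

/-- The nodes `x_j`, `0 ≤ j ≤ 2N`, of the graded mesh on `[a, b]` with grading exponent `r`. -/
def node (a b r : ℝ) (N j : ℕ) : ℝ :=
  if j ≤ N then a + (b - a) / 2 * ((j : ℝ) / (N : ℝ)) ^ r
  else b - (b - a) / 2 * (2 - (j : ℝ) / (N : ℝ)) ^ r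

/-- The hat function `φ_j` of the partition `x`, for an interior node `x_j` (so `1 ≤ j`). -/
def hat (x : ℕ → ℝ) (j : ℕ) (y : ℝ) : ℝ :=
  if y ∈ Icc (x (j - 1)) (x j) then (y - x (j - 1)) / (x j - x (j - 1))
  else if y ∈ Icc (x j) (x (j + 1)) then (x (j + 1) - y) / (x (j + 1) - x j)
  else 0

/-- The coefficient `a_{i,k} = ∫_a^b (φ_k(x_i) - φ_k(y)) / |x_i - y|^α dy`. -/
def coeff (a b α r : ℝ) (N i k : ℕ) : ℝ :=
  ∫ y in a..b, (hat (node a b r N) k (node a b r N i) - hat (node a b r N) k y) /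
    |node a b r N i - y| ^ α

/-- The collocation matrix `A = (a_{i,k})`, `1 ≤ i, k ≤ 2N - 1`. The index `i : Fin (2N - 1)`
stands for the node `x_{i+1}`. -/
def stiffness (a b α r : ℝ) (N : ℕ) : Matrix (Fin (2 * N - 1)) (Fin (2 * N - 1)) ℝ :=
  Matrix.of fun i k => coeff a b α r N (i + 1) (k + 1)

/-- The load vector at time `t`, with entries `f(x_i, t)`. -/
def load (a b r : ℝ) (f : ℝ → ℝ → ℝ) (N : ℕ) (t : ℝ) : Fin (2 * N - 1) → ℝ :=
  fun i => f (node a b r N (i + 1)) t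

/-- `U 0, …, U M` is computed by the Crank–Nicolson collocation scheme with step `τ = 1 / M`:
`(I + τ/2 A) U^j = (I - τ/2 A) U^{j-1} + τ F^{j-1/2}` for `1 ≤ j ≤ M`, and `U^0` is the vector of
nodal values of `u₀`. -/
def IsSchemeSolution (a b α r : ℝ) (u₀ : ℝ → ℝ) (f : ℝ → ℝ → ℝ) (N M : ℕ)
    (U : ℕ → Fin (2 * N - 1) → ℝ) : Prop :=
  (∀ i, U 0 i = u₀ (node a b r N (i + 1))) ∧
  ∀ j : ℕ, 1 ≤ j → j ≤ M →
    (1 + (1 / (M : ℝ) / 2) • stiffness a b α r N).mulVec (U j) =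
      (1 - (1 / (M : ℝ) / 2) • stiffness a b α r N).mulVec (U (j - 1)) +
        (1 / (M : ℝ)) • load a b r f N (((j : ℝ) - 1 / 2) * (1 / (M : ℝ)))

end

end NonlocalCN

namespace NonlocalCN

open Set MeasureTheory

/-! The proof is consistency plus maximum norm stability, with constants free of the mesh because
the kernel `|x - y| ^ (-α)` is integrable for `α < 1`.

Stability (`crankNicolson_stable`): `A` has nonpositive off-diagonal entries, nonnegative row sums
and a diagonal bounded by some `D` independent of `N`. Hence `(I + cA)⁻¹` is a maximum norm
contraction, while `I - cA` has norm at most `1 + 2cD`. With `c = τ/2` each step amplifies the error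
by at most `1 + τD`, so a residual of size `ρ` produces an error of at most `exp D * ρ`, without any
restriction on `τ`.

Consistency in space (`exists_bound_space_truncation`): the interpolant of `u` is exact at `x_i`, so
`A u + 𝓛 u` at `x_i` equals the interpolation error integrated against the kernel. Each half of the
mesh is moved to `[0, L]` with the singularity at `0`. On the first cell `[0, z]`, `z ~ N^(-r)`, the
error is `O(z^σ)` and the kernel contributes `z^(1-α)`, giving `N^(-r(1+σ-α))`. At `y` in a later
cell the mesh width is `O(y/j)` with `1/j = O(N⁻¹ y^(-1/r))`, so the bound on `∂_x²u` gives `O(N⁻²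
y^(σ-2/r))`. Integrated against the kernel, this leaves `N⁻² ∫_z^L y^(σ-α-2/r) dy` and a similar
term at the collocation point; the sign of `1+σ-α-2/r` yields the three cases, the logarithm coming
from `∫ dy/y`.

Consistency in time: the residual is compared with the equation at the midpoint `t_{k-1/2}`. Bounds
on `u` and `∂_t³u` bound `∂_t²u` uniformly in `x`; Taylor expansion then controls both the central
difference and the average of the two time levels, and boundedness of `𝓛` in the maximum norm
transfers the latter to `𝓛 u`. -/

/-! ### Integrals against the weakly singular kernel -/

theorem intervalIntegrable_abs_rpow {s : ℝ} (hs : -1 < s) (c d : ℝ) :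
    IntervalIntegrable (fun y : ℝ => |y| ^ s) volume c d := by
  have pos : ∀ e : ℝ, 0 ≤ e → IntervalIntegrable (fun y : ℝ => |y| ^ s) volume 0 e := by
    intro e he
    refine (intervalIntegral.intervalIntegrable_rpow' hs (a := 0) (b := e)).congr ?_
    intro y hy
    rw [uIoc_of_le he] at hy
    simp [abs_of_pos hy.1]
  have all : ∀ e : ℝ, IntervalIntegrable (fun y : ℝ => |y| ^ s) volume 0 e := by
    intro e
    rcases le_total 0 e with he | he
    · exact pos e he
    · have := (pos (-e) (by linarith)).comp_sub_left 0
      simpa using this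
  exact (all c).symm.trans (all d)

theorem intervalIntegrable_kernel {α : ℝ} (hα : α < 1) (x c d : ℝ) :
    IntervalIntegrable (fun y : ℝ => |x - y| ^ (-α)) volume c d := by
  have := (intervalIntegrable_abs_rpow (s := -α) (by linarith) (x - c) (x - d)).comp_sub_left x
  simpa using this

theorem integral_abs_rpow_neg {α h : ℝ} (hα : α < 1) (hh : 0 ≤ h) :
    ∫ y in (0 : ℝ)..h, |y| ^ (-α) = h ^ (1 - α) / (1 - α) := by
  have : ∫ y in (0 : ℝ)..h, |y| ^ (-α) = ∫ y in (0 : ℝ)..h, y ^ (-α) := by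
    refine intervalIntegral.integral_congr_ae (Filter.Eventually.of_forall fun y hy => ?_)
    rw [uIoc_of_le hh] at hy
    simp [abs_of_pos hy.1]
  rw [this, integral_rpow (Or.inl (by linarith)), Real.zero_rpow (by linarith)]
  ring_nf

theorem integral_kernel_le_of_mem {α x c d : ℝ} (hα : α < 1) (hx : x ∈ Icc c d) :
    ∫ y in c..d, |x - y| ^ (-α) ≤ 2 / (1 - α) * (d - c) ^ (1 - α) := by
  have left : ∫ y in c..x, |x - y| ^ (-α) = (x - c) ^ (1 - α) / (1 - α) := by
    rw [intervalIntegral.integral_comp_sub_left (fun z => |z| ^ (-α)) x, sub_self,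
      integral_abs_rpow_neg hα (by linarith [hx.1])]
  have right : ∫ y in x..d, |x - y| ^ (-α) = (d - x) ^ (1 - α) / (1 - α) := by
    have : ∫ y in x..d, |x - y| ^ (-α) = ∫ y in x..d, |y - x| ^ (-α) := by
      simp_rw [abs_sub_comm]
    rw [this, intervalIntegral.integral_comp_sub_right (fun z => |z| ^ (-α)) x, sub_self,
      integral_abs_rpow_neg hα (by linarith [hx.2])]
  rw [← intervalIntegral.integral_add_adjacent_intervals
    (intervalIntegrable_kernel hα x c x) (intervalIntegrable_kernel hα x x d), left, right]
  have h1 : (x - c) ^ (1 - α) ≤ (d - c) ^ (1 - α) :=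
    Real.rpow_le_rpow (by linarith [hx.1]) (by linarith [hx.2]) (by linarith)
  have h2 : (d - x) ^ (1 - α) ≤ (d - c) ^ (1 - α) :=
    Real.rpow_le_rpow (by linarith [hx.2]) (by linarith [hx.1]) (by linarith)
  have h3 : 0 < 1 - α := by linarith
  rw [← add_div, div_mul_eq_mul_div]
  gcongr
  linarith

/-- The weakly singular kernel integrates to at most a multiple of `h ^ (1 - α)` over every interval
of length `h`, wherever the singularity is. -/
theorem integral_kernel_le {α c d : ℝ} (hα₀ : 0 < α) (hα : α < 1) (x : ℝ) (hcd : c ≤ d) :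
    ∫ y in c..d, |x - y| ^ (-α) ≤ 2 / (1 - α) * (d - c) ^ (1 - α) := by
  -- Moving the singularity to the point of `[c, d]` nearest to `x` only decreases the distance to
  -- each `y` there, so it only increases the kernel.
  set x' := max c (min x d) with hx'
  have hmem : x' ∈ Icc c d := ⟨le_max_left _ _, max_le hcd (min_le_right _ _)⟩
  refine le_trans ?_ (integral_kernel_le_of_mem hα hmem)
  refine intervalIntegral.integral_mono_ae_restrict hcd (intervalIntegrable_kernel hα x c d)
    (intervalIntegrable_kernel hα x' c d) ?_
  have hne : ∀ᵐ y ∂(volume.restrict (Icc c d)), y ≠ x' :=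
    ae_restrict_of_ae (Measure.ae_ne volume x')
  filter_upwards [hne, ae_restrict_mem measurableSet_Icc] with y hy hyI
  refine Real.rpow_le_rpow_of_nonpos (abs_pos.2 (sub_ne_zero.2 hy.symm)) ?_ (by linarith)
  rcases le_total x c with h | h
  · have : x' = c := by rw [hx', max_eq_left]; exact (min_le_left _ _).trans h
    rw [this, abs_sub_comm, abs_sub_comm x, abs_of_nonneg (by linarith [hyI.1]),
      abs_of_nonneg (by linarith [hyI.1])]
    linarith
  · rcases le_total x d with h' | h'
    · have : x' = x := by rw [hx', min_eq_left h', max_eq_right h]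
      rw [this]
    · have : x' = d := by rw [hx', min_eq_right h', max_eq_right hcd]
      rw [this, abs_of_nonneg (by linarith [hyI.2]), abs_of_nonneg (by linarith [hyI.2])]
      linarith

/-- Bounded functions times the kernel are integrable. -/
theorem intervalIntegrable_mul_kernel {α c d B : ℝ} {E : ℝ → ℝ} (hα : α < 1) (x : ℝ) (hcd : c ≤ d)
    (hE : AEStronglyMeasurable E (volume.restrict (Ioc c d)))
    (hB : ∀ y ∈ Ioc c d, |E y| ≤ B) :
    IntervalIntegrable (fun y => E y * |x - y| ^ (-α)) volume c d := by
  rw [intervalIntegrable_iff_integrableOn_Ioc_of_le hcd]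
  have hk := intervalIntegrable_kernel hα x c d
  rw [intervalIntegrable_iff_integrableOn_Ioc_of_le hcd] at hk
  exact Integrable.bdd_mul (c := B) hk hE
    ((ae_restrict_iff' measurableSet_Ioc).2 (Filter.Eventually.of_forall hB))

theorem abs_integral_mul_kernel_le {α c d B : ℝ} {E : ℝ → ℝ} (hα₀ : 0 < α) (hα : α < 1) (x : ℝ)
    (hcd : c ≤ d) (hB₀ : 0 ≤ B) (hB : ∀ y ∈ Ioc c d, |E y| ≤ B) :
    |∫ y in c..d, E y * |x - y| ^ (-α)| ≤ B * (2 / (1 - α) * (d - c) ^ (1 - α)) := by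
  have h := intervalIntegral.norm_integral_le_of_norm_le (μ := volume)
    (f := fun y => E y * |x - y| ^ (-α)) (g := fun y => B * |x - y| ^ (-α)) hcd
    (Filter.Eventually.of_forall fun y hy => ?_) ((intervalIntegrable_kernel hα x c d).const_mul B)
  · rw [intervalIntegral.integral_const_mul, Real.norm_eq_abs] at h
    exact h.trans (mul_le_mul_of_nonneg_left (integral_kernel_le hα₀ hα x hcd) hB₀)
  · rw [norm_mul, Real.norm_eq_abs, Real.norm_eq_abs,
      abs_of_nonneg (Real.rpow_nonneg (abs_nonneg (x - y)) _)]
    exact mul_le_mul_of_nonneg_right (hB y hy) (Real.rpow_nonneg (abs_nonneg _) _)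

theorem rpow_le_two_rpow_abs_mul {X y : ℝ} (p : ℝ) (hX : 0 < X) (h1 : X / 2 ≤ y)
    (h2 : y ≤ 2 * X) : y ^ p ≤ 2 ^ |p| * X ^ p := by
  have hy : 0 < y := by linarith
  rcases le_total 0 p with hp | hp
  · rw [abs_of_nonneg hp, ← Real.mul_rpow (by norm_num) hX.le]
    exact Real.rpow_le_rpow hy.le h2 hp
  · rw [abs_of_nonpos hp, Real.rpow_neg (by norm_num), ← Real.inv_rpow (by norm_num),
      ← Real.mul_rpow (by norm_num) hX.le]
    exact Real.rpow_le_rpow_of_nonpos (by linarith) (by linarith) hp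

/-- A function that grows like `y ^ p` near the origin, integrated against the kernel. -/
theorem abs_integral_mul_kernel_le_of_rpow {α p z L X B : ℝ} {E : ℝ → ℝ} (hα₀ : 0 < α)
    (hα : α < 1) (hz : 0 < z) (hzL : z ≤ L) (hX : 0 < X) (hB₀ : 0 ≤ B)
    (hB : ∀ y ∈ Ioc z L, |E y| ≤ B * y ^ p) :
    |∫ y in z..L, E y * |X - y| ^ (-α)| ≤
      B * (2 ^ α * (∫ y in z..L, y ^ (p - α)) +
        2 ^ |p| * (2 / (1 - α)) * 2 ^ (1 - α) * X ^ (p + 1 - α)) := by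
  -- Where `|X - y| ≥ y / 2` the kernel is at most `2 ^ α * y ^ (-α)`. Otherwise `y` lies in `S`,
  -- where `y ^ p` is comparable to `X ^ p` and the kernel is integrated directly.
  set S : Set ℝ := Ioc (X / 2) (2 * X) with hS
  have hint1 : IntervalIntegrable (fun y : ℝ => y ^ (p - α)) volume z L :=
    intervalIntegral.intervalIntegrable_rpow (Or.inr (by
      rw [uIcc_of_le hzL]; exact fun h => absurd h.1 (not_le.2 hz)))
  have hkS : IntegrableOn (fun y : ℝ => |X - y| ^ (-α)) S := by
    have := intervalIntegrable_kernel hα X (X / 2) (2 * X)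
    rwa [intervalIntegrable_iff_integrableOn_Ioc_of_le (by linarith)] at this
  have hind : Integrable (S.indicator fun y : ℝ => |X - y| ^ (-α)) :=
    (integrable_indicator_iff measurableSet_Ioc).2 hkS
  have hind' : IntervalIntegrable (S.indicator fun y : ℝ => |X - y| ^ (-α)) volume z L :=
    hind.intervalIntegrable
  have hindle : ∫ y in z..L, S.indicator (fun y : ℝ => |X - y| ^ (-α)) y ≤
      2 / (1 - α) * (2 ^ (1 - α) * X ^ (1 - α)) := by
    rw [intervalIntegral.integral_of_le hzL]
    calc _ ≤ ∫ y, S.indicator (fun y : ℝ => |X - y| ^ (-α)) y :=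
          setIntegral_le_integral hind (Filter.Eventually.of_forall fun y =>
            indicator_nonneg (fun _ _ => Real.rpow_nonneg (abs_nonneg _) _) y)
      _ = ∫ y in (X / 2)..(2 * X), |X - y| ^ (-α) := by
          rw [integral_indicator measurableSet_Ioc, intervalIntegral.integral_of_le (by linarith)]
      _ ≤ 2 / (1 - α) * (2 * X - X / 2) ^ (1 - α) :=
          integral_kernel_le hα₀ hα X (by linarith)
      _ ≤ _ := by
          rw [← Real.mul_rpow (by norm_num) hX.le]
          have : 0 < 1 - α := by linarith
          gcongr
          · linarith
          · linarith
  have h := intervalIntegral.norm_integral_le_of_norm_le (μ := volume)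
    (f := fun y => E y * |X - y| ^ (-α))
    (g := fun y => B * (2 ^ α * y ^ (p - α)) +
      B * (2 ^ |p| * X ^ p) * S.indicator (fun y : ℝ => |X - y| ^ (-α)) y) hzL
    (Filter.Eventually.of_forall fun y hy => ?_)
    (((hint1.const_mul _).const_mul _).add (hind'.const_mul _))
  · rw [intervalIntegral.integral_add ((hint1.const_mul _).const_mul _) (hind'.const_mul _),
      intervalIntegral.integral_const_mul, intervalIntegral.integral_const_mul,
      intervalIntegral.integral_const_mul, Real.norm_eq_abs] at h
    refine h.trans ?_
    have e : X ^ (p + 1 - α) = X ^ p * X ^ (1 - α) := by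
      rw [← Real.rpow_add hX]; ring_nf
    rw [e, mul_add B]
    have h2 := mul_le_mul_of_nonneg_left hindle
      (show 0 ≤ B * (2 ^ |p| * X ^ p) by positivity)
    linarith
  · have hy0 : 0 < y := hz.trans hy.1
    have hk0 : 0 ≤ |X - y| ^ (-α) := Real.rpow_nonneg (abs_nonneg _) _
    rw [norm_mul, Real.norm_eq_abs, Real.norm_eq_abs, abs_of_nonneg hk0]
    have hEy := mul_le_mul_of_nonneg_right (hB y hy) hk0
    refine hEy.trans ?_
    by_cases hc : y / 2 ≤ |X - y|
    · have hk : |X - y| ^ (-α) ≤ 2 ^ α * y ^ (-α) := by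
        refine (Real.rpow_le_rpow_of_nonpos (by positivity) hc (by linarith)).trans ?_
        rw [Real.div_rpow hy0.le (by norm_num), Real.rpow_neg (by norm_num : (0 : ℝ) ≤ 2)]
        field_simp
        rfl
      have e : y ^ (p - α) = y ^ p * y ^ (-α) := by rw [← Real.rpow_add hy0]; ring_nf
      have h3 : B * y ^ p * |X - y| ^ (-α) ≤ B * (2 ^ α * y ^ (p - α)) := by
        rw [e]
        have := mul_le_mul_of_nonneg_left hk (show 0 ≤ B * y ^ p by positivity)
        linarith
      have h4 : 0 ≤ S.indicator (fun y : ℝ => |X - y| ^ (-α)) y :=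
        indicator_nonneg (fun _ _ => Real.rpow_nonneg (abs_nonneg _) _) y
      have h5 : 0 ≤ B * (2 ^ |p| * X ^ p) * S.indicator (fun y : ℝ => |X - y| ^ (-α)) y := by
        positivity
      linarith
    · rw [not_le, abs_lt] at hc
      have hyS : y ∈ S := ⟨by linarith [hc.1, hc.2], by linarith [hc.1, hc.2]⟩
      rw [indicator_of_mem hyS]
      have h3 := mul_le_mul_of_nonneg_left (rpow_le_two_rpow_abs_mul p hX hyS.1.le hyS.2) hB₀
      have h4 := mul_le_mul_of_nonneg_right h3 hk0
      have h5 : 0 ≤ B * (2 ^ α * y ^ (p - α)) := by positivity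
      linarith

/-! ### Linear interpolation on the graded half mesh -/

noncomputable section

/-- The nodes of the mesh on `[0, L]` graded towards the origin. -/
def gradedNode (L r : ℝ) (N j : ℕ) : ℝ := L * ((j : ℝ) / (N : ℝ)) ^ r

/-- The linear interpolant through `(c, v)` and `(d, w)`. -/
def linInterp (c d v w y : ℝ) : ℝ := v * ((d - y) / (d - c)) + w * ((y - c) / (d - c))

/-- The convergence rate in the number of cells, depending on the exponent `β = r (1 + σ - α)`. -/
def spaceRate (β : ℝ) (N : ℕ) : ℝ :=
  if β < 2 then (N : ℝ) ^ (-β) else if β = 2 then (N : ℝ) ^ (-β) * Real.log N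
  else (N : ℝ) ^ (-2 : ℝ)

end

/-- Two mean value theorems write the error as `(y - c) * (G' η - G' ξ)`, and a third bounds the
difference of slopes. The sharp constant `1/8` is not needed. -/
theorem abs_sub_linInterp_le {G G' G'' : ℝ → ℝ} {c d y M : ℝ} (hcd : c < d)
    (hG : ∀ x ∈ Icc c d, HasDerivAt G (G' x) x) (hG' : ∀ x ∈ Icc c d, HasDerivAt G' (G'' x) x)
    (hM : ∀ x ∈ Icc c d, |G'' x| ≤ M) (hy : y ∈ Icc c d) :
    |G y - linInterp c d (G c) (G d) y| ≤ M * (d - c) ^ 2 := by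
  have hdc : 0 < d - c := sub_pos.2 hcd
  have hM0 : 0 ≤ M := (abs_nonneg _).trans (hM y hy)
  rcases hy.1.eq_or_lt with rfl | hcy
  · have : G c - linInterp c d (G c) (G d) c = 0 := by
      unfold linInterp; field_simp; ring
    rw [this, abs_zero]; positivity
  · obtain ⟨ξ, hξ, eξ⟩ := exists_hasDerivAt_eq_slope G G' hcd
      (fun x hx => (hG x hx).continuousAt.continuousWithinAt)
      (fun x hx => hG x (Ioo_subset_Icc_self hx))
    obtain ⟨η, hη, eη⟩ := exists_hasDerivAt_eq_slope G G' hcy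
      (fun x hx => (hG x ⟨hx.1, hx.2.trans hy.2⟩).continuousAt.continuousWithinAt)
      (fun x hx => hG x ⟨hx.1.le, hx.2.le.trans hy.2⟩)
    have hyc : 0 < y - c := sub_pos.2 hcy
    have e : G y - linInterp c d (G c) (G d) y = (y - c) * (G' η - G' ξ) := by
      rw [eξ, eη]; unfold linInterp; field_simp; ring
    have hmv := Convex.norm_image_sub_le_of_norm_hasDerivWithin_le (C := M)
      (fun x hx => (hG' x hx).hasDerivWithinAt) hM (convex_Icc c d)
      (Ioo_subset_Icc_self hξ) (show η ∈ Icc c d from ⟨hη.1.le, hη.2.le.trans hy.2⟩)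
    rw [Real.norm_eq_abs, Real.norm_eq_abs] at hmv
    have hηξ : |η - ξ| ≤ d - c := by
      rw [abs_le]; constructor <;> linarith [hη.1, hη.2, hξ.1, hξ.2, hy.2]
    rw [e, abs_mul, abs_of_pos hyc]
    calc (y - c) * |G' η - G' ξ| ≤ (d - c) * (M * (d - c)) := by
          gcongr
          · exact hy.2
          · exact hmv.trans (by gcongr)
      _ = _ := by ring

theorem abs_linInterp_le {c d v w y B : ℝ} (hcd : c < d) (hy : y ∈ Icc c d) (hv : |v| ≤ B)
    (hw : |w| ≤ B) : |linInterp c d v w y| ≤ B := by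
  have hdc : 0 < d - c := sub_pos.2 hcd
  have h1 : 0 ≤ (d - y) / (d - c) := div_nonneg (by linarith [hy.2]) hdc.le
  have h2 : 0 ≤ (y - c) / (d - c) := div_nonneg (by linarith [hy.1]) hdc.le
  have h3 : (d - y) / (d - c) + (y - c) / (d - c) = 1 := by field_simp; ring
  unfold linInterp
  refine (abs_add_le _ _).trans ?_
  rw [abs_mul, abs_mul, abs_of_nonneg h1, abs_of_nonneg h2]
  calc _ ≤ B * ((d - y) / (d - c)) + B * ((y - c) / (d - c)) := by gcongr
    _ = B := by rw [← mul_add, h3, mul_one]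

theorem gradedNode_zero {L r : ℝ} (hr : 0 < r) (N : ℕ) : gradedNode L r N 0 = 0 := by
  simp [gradedNode, Real.zero_rpow hr.ne']

theorem gradedNode_self {L r : ℝ} {N : ℕ} (hN : 1 ≤ N) : gradedNode L r N N = L := by
  have : (N : ℝ) ≠ 0 := by positivity
  simp [gradedNode, div_self this]

theorem gradedNode_one {L r : ℝ} {N : ℕ} : gradedNode L r N 1 = L * (N : ℝ) ^ (-r) := by
  rw [gradedNode, Nat.cast_one, one_div, Real.inv_rpow (Nat.cast_nonneg N),
    Real.rpow_neg (Nat.cast_nonneg N)]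

theorem gradedNode_strictMono {L r : ℝ} {N : ℕ} (hL : 0 < L) (hr : 0 < r) (hN : 1 ≤ N) :
    StrictMono (gradedNode L r N) := by
  intro i j hij
  have : (0 : ℝ) < N := by positivity
  unfold gradedNode
  refine mul_lt_mul_of_pos_left (Real.rpow_lt_rpow (by positivity) ?_ hr) hL
  gcongr

theorem gradedNode_pos {L r : ℝ} {N j : ℕ} (hL : 0 < L) (hN : 1 ≤ N) (hj : 1 ≤ j) :
    0 < gradedNode L r N j := by
  have : (0 : ℝ) < N := by positivity
  have : (0 : ℝ) < j := by positivity
  unfold gradedNode; positivity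

/-- Consecutive nodes have ratio `(1 + 1/j) ^ r ≤ exp (r/j)`, and `exp t ≤ 1 + t * exp t`. The first
cell, `j = 0`, is excluded and treated separately. -/
theorem gradedNode_succ_sub_le {L r : ℝ} {N j : ℕ} (hL : 0 < L) (hr : 0 < r) (hN : 1 ≤ N)
    (hj : 1 ≤ j) :
    gradedNode L r N (j + 1) - gradedNode L r N j ≤
      r * Real.exp r * (gradedNode L r N j / j) := by
  have hN' : (0 : ℝ) < N := by positivity
  have hj' : (0 : ℝ) < j := by positivity
  have hj1 : (1 : ℝ) ≤ j := by exact_mod_cast hj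
  have e : gradedNode L r N (j + 1) = gradedNode L r N j * (1 + 1 / (j : ℝ)) ^ r := by
    unfold gradedNode
    rw [mul_assoc, ← Real.mul_rpow (by positivity) (by positivity)]
    congr 2
    push_cast
    field_simp
  have hs : (1 + 1 / (j : ℝ)) ^ r ≤ 1 + r / j * Real.exp r := by
    have h1 : (1 + 1 / (j : ℝ)) ^ r ≤ Real.exp (r / j) := by
      rw [show r / (j : ℝ) = 1 / j * r by ring, Real.exp_mul]
      refine Real.rpow_le_rpow (by positivity) ?_ hr.le
      rw [add_comm]; exact Real.add_one_le_exp _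
    have h2 : Real.exp (r / j) ≤ Real.exp r := Real.exp_le_exp.2 (div_le_self hr.le hj1)
    have h3 := Real.add_one_le_exp (-(r / (j : ℝ)))
    have h4 : Real.exp (r / j) * Real.exp (-(r / j)) = 1 := by rw [← Real.exp_add]; simp
    have h5 : 0 < Real.exp (r / (j : ℝ)) := Real.exp_pos _
    have h6 : r / j * Real.exp (r / j) ≤ r / j * Real.exp r := by gcongr
    nlinarith
  have hg : 0 ≤ gradedNode L r N j := (gradedNode_pos hL hN hj).le
  rw [e]
  have := mul_le_mul_of_nonneg_left hs hg
  calc _ ≤ gradedNode L r N j * (1 + r / j * Real.exp r) - gradedNode L r N j := by linarith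
    _ = _ := by ring

theorem exists_gradedNode_cell {L r y : ℝ} {N : ℕ} (hN : 1 ≤ N)
    (hy : y ∈ Ioc (gradedNode L r N 1) L) :
    ∃ j, 1 ≤ j ∧ j < N ∧ y ∈ Icc (gradedNode L r N j) (gradedNode L r N (j + 1)) := by
  classical
  have hex : ∃ m, y ≤ gradedNode L r N (m + 1) :=
    ⟨N - 1, by rw [Nat.sub_add_cancel hN, gradedNode_self hN]; exact hy.2⟩
  have hmin := fun m hm => Nat.find_min hex (m := m) hm
  have hspec := Nat.find_spec hex
  have hle : Nat.find hex ≤ N - 1 :=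
    Nat.find_min' hex (by rw [Nat.sub_add_cancel hN, gradedNode_self hN]; exact hy.2)
  have hpos : 1 ≤ Nat.find hex := by
    rw [Nat.one_le_iff_ne_zero]
    intro h0
    rw [h0] at hspec
    exact absurd hy.1 (not_lt.2 hspec)
  refine ⟨Nat.find hex, hpos, by omega, ?_, hspec⟩
  have := hmin (Nat.find hex - 1) (by omega)
  rw [Nat.sub_add_cancel hpos] at this
  exact (not_le.1 this).le

/-- Interpolation error on a cell of the graded mesh, for a function with an algebraic singularity
at the origin. -/
theorem abs_sub_linInterp_gradedNode_le {L r σ K y : ℝ} {G G' G'' : ℝ → ℝ} {N j : ℕ}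
    (hL : 0 < L) (hr : 0 < r) (hσ₀ : 0 < σ) (hσ₁ : σ < 1) (hN : 1 ≤ N) (hj : 1 ≤ j) (hjN : j < N)
    (hK : 0 ≤ K)
    (hG : ∀ x ∈ Ioc 0 L, HasDerivAt G (G' x) x) (hG' : ∀ x ∈ Ioc 0 L, HasDerivAt G' (G'' x) x)
    (hM : ∀ x ∈ Ioc 0 L, |G'' x| ≤ K * x ^ (σ - 2))
    (hy : y ∈ Icc (gradedNode L r N j) (gradedNode L r N (j + 1))) :
    |G y - linInterp (gradedNode L r N j) (gradedNode L r N (j + 1))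
        (G (gradedNode L r N j)) (G (gradedNode L r N (j + 1))) y| ≤
      K * (4 * (r * Real.exp r) ^ 2 * L ^ (2 / r)) * (N : ℝ) ^ (-2 : ℝ) * y ^ (σ - 2 / r) := by
  set c := gradedNode L r N j with hc
  set d := gradedNode L r N (j + 1) with hd
  have hmono := gradedNode_strictMono hL hr hN
  have hcd : c < d := hmono (Nat.lt_succ_self j)
  have hc0 : 0 < c := gradedNode_pos hL hN hj
  have hdL : d ≤ L := by
    rw [← gradedNode_self (L := L) (r := r) hN]; exact hmono.monotone (by omega)
  have hsub : Icc c d ⊆ Ioc 0 L := fun x hx => ⟨hc0.trans_le hx.1, hx.2.trans hdL⟩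
  have hy0 : 0 < y := hc0.trans_le hy.1
  have hN' : (0 : ℝ) < N := by positivity
  have hj' : (0 : ℝ) < j := by positivity
  have hj1 : (1 : ℝ) ≤ j := by exact_mod_cast hj
  have h1 := abs_sub_linInterp_le (M := K * c ^ (σ - 2)) hcd (fun x hx => hG x (hsub hx))
    (fun x hx => hG' x (hsub hx)) (fun x hx => (hM x (hsub hx)).trans (by
      refine mul_le_mul_of_nonneg_left ?_ hK
      exact Real.rpow_le_rpow_of_nonpos hc0 hx.1 (by linarith))) hy
  refine h1.trans ?_
  have h2 : (d - c) ^ 2 ≤ (r * Real.exp r * (c / j)) ^ 2 :=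
    pow_le_pow_left₀ (by linarith) (gradedNode_succ_sub_le hL hr hN hj) 2
  have h3 : c ^ (σ - 2) * c ^ 2 = c ^ σ := by
    rw [← Real.rpow_natCast c 2, ← Real.rpow_add hc0]; norm_num
  have h4 : c ^ σ ≤ y ^ σ := Real.rpow_le_rpow hc0.le hy.1 hσ₀.le
  -- Inverting `y ≤ L * ((j+1)/N) ^ r` and using `j + 1 ≤ 2 * j` bounds `1/j` by `2 * N⁻¹ * (y/L) ^
  -- (-1/r)`; the factor `4` is this `2` squared.
  have h5 : (1 / (j : ℝ)) ^ 2 ≤ 4 * L ^ (2 / r) * (N : ℝ) ^ (-2 : ℝ) * y ^ (-(2 / r)) := by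
    have hyd : (y / L) ^ (1 / r) ≤ (j + 1) / N := by
      have : y / L ≤ (((j + 1 : ℕ) : ℝ) / N) ^ r := by
        rw [div_le_iff₀ hL, mul_comm]; exact hy.2
      calc (y / L) ^ (1 / r) ≤ ((((j + 1 : ℕ) : ℝ) / N) ^ r) ^ (1 / r) :=
            Real.rpow_le_rpow (by positivity) this (by positivity)
        _ = (j + 1) / N := by
            rw [← Real.rpow_mul (by positivity), mul_one_div_cancel hr.ne', Real.rpow_one]
            push_cast; rfl
    have hyd2 : (y / L) ^ (1 / r) ≤ 2 * j / N := hyd.trans (by gcongr; linarith)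
    have hpos : 0 < (y / L) ^ (1 / r) := by positivity
    have hsq : ((y / L) ^ (1 / r)) ^ 2 ≤ (2 * j / N) ^ 2 := pow_le_pow_left₀ hpos.le hyd2 2
    have e1 : ((y / L) ^ (1 / r)) ^ 2 = y ^ (2 / r) / L ^ (2 / r) := by
      rw [← Real.rpow_natCast, ← Real.rpow_mul (by positivity), Real.div_rpow hy0.le hL.le]
      norm_num
      ring_nf
    rw [e1] at hsq
    rw [Real.rpow_neg hy0.le, Real.rpow_neg hN'.le, Real.rpow_two]
    have hyr : 0 < y ^ (2 / r) := by positivity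
    have hLr : 0 < L ^ (2 / r) := by positivity
    rw [div_le_iff₀ hLr, div_pow, div_mul_eq_mul_div, le_div_iff₀ (by positivity)] at hsq
    rw [div_pow, one_pow, div_le_iff₀ (by positivity)]
    field_simp
    nlinarith
  have e6 : y ^ (σ - 2 / r) = y ^ σ * y ^ (-(2 / r)) := by rw [← Real.rpow_add hy0]; ring_nf
  calc K * c ^ (σ - 2) * (d - c) ^ 2 ≤ K * c ^ (σ - 2) * (r * Real.exp r * (c / j)) ^ 2 := by gcongr
    _ = K * (r * Real.exp r) ^ 2 * (c ^ (σ - 2) * c ^ 2) * (1 / (j : ℝ)) ^ 2 := by ring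
    _ ≤ K * (r * Real.exp r) ^ 2 * y ^ σ *
        (4 * L ^ (2 / r) * (N : ℝ) ^ (-2 : ℝ) * y ^ (-(2 / r))) := by
        rw [h3]; gcongr
    _ = _ := by rw [e6]; ring

/-! ### The three regimes of the spatial rate -/

theorem integral_rpow_le {s z L : ℝ} (hz : 0 < z) (hzL : z ≤ L) (hs : s < 0) :
    ∫ y in z..L, y ^ (s - 1) ≤ z ^ s / (-s) := by
  have h0 : (0 : ℝ) ∉ uIcc z L := by
    rw [uIcc_of_le hzL]; exact fun h => absurd h.1 (not_le.2 hz)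
  rw [integral_rpow (Or.inr ⟨by linarith, h0⟩), sub_add_cancel, ← neg_div_neg_eq]
  have : 0 ≤ L ^ s := Real.rpow_nonneg (hz.le.trans hzL) _
  have : 0 < -s := by linarith
  gcongr
  linarith

theorem integral_rpow_le_of_pos {s z L : ℝ} (hz : 0 < z) (hs : 0 < s) :
    ∫ y in z..L, y ^ (s - 1) ≤ L ^ s / s := by
  rw [integral_rpow (Or.inl (by linarith)), sub_add_cancel]
  have : 0 ≤ z ^ s := Real.rpow_nonneg hz.le _
  gcongr
  linarith

theorem spaceRate_nonneg (β : ℝ) (N : ℕ) : 0 ≤ spaceRate β N := by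
  unfold spaceRate
  have := Real.log_natCast_nonneg N
  split_ifs <;> positivity

/-- The three quantities that control the interpolation error against the kernel are bounded by the
convergence rate. -/
theorem exists_bound_spaceRate {L r s : ℝ} (hL : 0 < L) (hr : 0 < r) :
    ∃ C, 0 ≤ C ∧ ∀ N : ℕ, 1 ≤ N → (r * s = 2 → 2 ≤ N) →
      (gradedNode L r N 1) ^ s ≤ C * spaceRate (r * s) N ∧
      (N : ℝ) ^ (-2 : ℝ) * (∫ y in (gradedNode L r N 1)..L, y ^ (s - 2 / r - 1)) ≤
        C * spaceRate (r * s) N ∧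
      ∀ X ∈ Icc (gradedNode L r N 1) (2 * L),
        (N : ℝ) ^ (-2 : ℝ) * X ^ (s - 2 / r) ≤ C * spaceRate (r * s) N := by
  have hz1 : ∀ N : ℕ, 1 ≤ N → ∀ q : ℝ,
      (gradedNode L r N 1) ^ q = L ^ q * (N : ℝ) ^ (-(r * q)) := by
    intro N hN q
    rw [gradedNode_one, Real.mul_rpow hL.le (by positivity), ← Real.rpow_mul (by positivity),
      neg_mul]
  have hz0 : ∀ N : ℕ, 1 ≤ N → 0 < gradedNode L r N 1 := fun N hN => gradedNode_pos hL hN le_rfl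
  have hzL : ∀ N : ℕ, 1 ≤ N → gradedNode L r N 1 ≤ L := fun N hN => by
    conv_rhs => rw [← gradedNode_self (L := L) (r := r) hN]
    exact (gradedNode_strictMono hL hr hN).monotone hN
  -- The sign of `q` is that of `r * s - 2`: it decides whether `∫ y ^ (q - 1)` is dominated by the
  -- lower end, logarithmic, or bounded.
  set q := s - 2 / r with hq
  have hrq : r * q = r * s - 2 := by rw [hq]; field_simp
  rcases lt_trichotomy (r * s) 2 with h | h | h
  · have hq0 : q < 0 := by
      by_contra hc
      have := mul_nonneg hr.le (not_lt.1 hc)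
      linarith
    have hrate : ∀ N, spaceRate (r * s) N = (N : ℝ) ^ (-(r * s)) := fun N => by
      simp [spaceRate, h]
    have hmul : ∀ N : ℕ, 1 ≤ N →
        (N : ℝ) ^ (-2 : ℝ) * (gradedNode L r N 1) ^ q = L ^ q * (N : ℝ) ^ (-(r * s)) := by
      intro N hN
      have : (0 : ℝ) < N := by positivity
      rw [hz1 N hN, mul_left_comm, ← Real.rpow_add this, hrq]
      ring_nf
    have hq' : 0 < -q := by linarith
    refine ⟨L ^ s + L ^ q / (-q) + L ^ q, by positivity, fun N hN _ => ?_⟩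
    rw [hrate]
    have hNs : 0 ≤ (N : ℝ) ^ (-(r * s)) := by positivity
    refine ⟨?_, ?_, fun X hX => ?_⟩
    · rw [hz1 N hN]
      gcongr
      have : 0 ≤ L ^ q / (-q) := by positivity
      have : 0 ≤ L ^ q := by positivity
      linarith
    · calc _ ≤ (N : ℝ) ^ (-2 : ℝ) * ((gradedNode L r N 1) ^ q / (-q)) := by
            gcongr
            exact integral_rpow_le (hz0 N hN) (hzL N hN) hq0
        _ = L ^ q / (-q) * (N : ℝ) ^ (-(r * s)) := by rw [mul_div_assoc', hmul N hN]; ring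
        _ ≤ _ := by
            gcongr
            have : 0 ≤ L ^ s := by positivity
            have : 0 ≤ L ^ q := by positivity
            linarith
    · calc _ ≤ (N : ℝ) ^ (-2 : ℝ) * (gradedNode L r N 1) ^ q :=
          mul_le_mul_of_nonneg_left (Real.rpow_le_rpow_of_nonpos (hz0 N hN) hX.1 hq0.le)
            (by positivity)
        _ = _ := hmul N hN
        _ ≤ _ := by
            gcongr
            have : 0 ≤ L ^ s := by positivity
            have : 0 ≤ L ^ q / (-q) := by positivity
            linarith
  · have hq0 : q = 0 := by
      have : r * q = 0 := by linarith
      exact (mul_eq_zero.1 this).resolve_left hr.ne'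
    have hrate : ∀ N, spaceRate (r * s) N = (N : ℝ) ^ (-2 : ℝ) * Real.log N := fun N => by
      simp [spaceRate, h]
    have hl2 : 0 < Real.log 2 := Real.log_pos (by norm_num)
    -- The requirement `2 ≤ N` enters here: `log N` vanishes at `N = 1` and could not absorb the
    -- terms without a logarithm.
    have hlog : ∀ N : ℕ, 2 ≤ N → 1 ≤ 1 / Real.log 2 * Real.log N := by
      intro N hN
      have : Real.log 2 ≤ Real.log N := Real.log_le_log (by norm_num) (by exact_mod_cast hN)
      rw [one_div, inv_mul_eq_div, le_div_iff₀ hl2]; linarith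
    refine ⟨L ^ s / Real.log 2 + r + 1 / Real.log 2, by positivity, fun N hN hN2 => ?_⟩
    rw [hrate, hq0]
    have hNpos : (0 : ℝ) < N := by positivity
    have hlN := hlog N (hN2 h)
    have hln0 : 0 ≤ Real.log N := Real.log_natCast_nonneg N
    have hN2' : 0 ≤ (N : ℝ) ^ (-2 : ℝ) := by positivity
    have hLs : 0 ≤ L ^ s := by positivity
    refine ⟨?_, ?_, fun X hX => ?_⟩
    · rw [hz1 N hN, h]
      calc _ ≤ L ^ s * ((N : ℝ) ^ (-2 : ℝ) * (1 / Real.log 2 * Real.log N)) := by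
            gcongr
            exact le_mul_of_one_le_right hN2' hlN
        _ = L ^ s / Real.log 2 * ((N : ℝ) ^ (-2 : ℝ) * Real.log N) := by ring
        _ ≤ _ := by
            gcongr
            have : 0 ≤ 1 / Real.log 2 := by positivity
            linarith
    · have : ∫ y in (gradedNode L r N 1)..L, y ^ ((0 : ℝ) - 1) = r * Real.log N := by
        have h0 : (0 : ℝ) ∉ uIcc (gradedNode L r N 1) L := by
          rw [uIcc_of_le (hzL N hN)]; exact fun h => absurd h.1 (not_le.2 (hz0 N hN))
        have e : ∀ y : ℝ, y ^ ((0 : ℝ) - 1) = 1 / y := fun y => by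
          rw [zero_sub, Real.rpow_neg_one, one_div]
        simp_rw [e]
        rw [integral_one_div h0, gradedNode_one, Real.log_div hL.ne' (by positivity),
          Real.log_mul hL.ne' (by positivity), Real.log_rpow hNpos]
        ring
      rw [this]
      calc _ = r * ((N : ℝ) ^ (-2 : ℝ) * Real.log N) := by ring
        _ ≤ _ := by
            gcongr
            have : 0 ≤ 1 / Real.log 2 := by positivity
            have : 0 ≤ L ^ s / Real.log 2 := by positivity
            linarith
    · rw [Real.rpow_zero]
      calc _ ≤ (N : ℝ) ^ (-2 : ℝ) * (1 / Real.log 2 * Real.log N) := by gcongr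
        _ = 1 / Real.log 2 * ((N : ℝ) ^ (-2 : ℝ) * Real.log N) := by ring
        _ ≤ _ := by
            gcongr
            have : 0 ≤ L ^ s / Real.log 2 := by positivity
            linarith
  · have hq0 : 0 < q := by
      by_contra hc
      have := mul_nonpos_of_nonneg_of_nonpos hr.le (not_lt.1 hc)
      linarith
    have hrate : ∀ N, spaceRate (r * s) N = (N : ℝ) ^ (-2 : ℝ) := fun N => by
      simp [spaceRate, h.not_gt, h.ne']
    refine ⟨L ^ s + L ^ q / q + (2 * L) ^ q, by positivity, fun N hN _ => ?_⟩
    rw [hrate]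
    have hN1 : (1 : ℝ) ≤ N := by exact_mod_cast hN
    have h1 : 0 ≤ L ^ s := by positivity
    have h2 : 0 ≤ L ^ q / q := by positivity
    have h3 : 0 ≤ (2 * L) ^ q := by positivity
    refine ⟨?_, ?_, fun X hX => ?_⟩
    · rw [hz1 N hN]
      have : (N : ℝ) ^ (-(r * s)) ≤ (N : ℝ) ^ (-2 : ℝ) :=
        Real.rpow_le_rpow_of_exponent_le hN1 (by linarith)
      gcongr
      linarith
    · rw [mul_comm]
      gcongr
      exact (integral_rpow_le_of_pos (hz0 N hN) hq0).trans (by linarith)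
    · rw [mul_comm]
      gcongr
      have : X ^ q ≤ (2 * L) ^ q := Real.rpow_le_rpow ((hz0 N hN).le.trans hX.1) hX.2 hq0.le
      linarith

/-- Interpolation error on the half mesh `[0, L]`, integrated against the kernel. -/
theorem exists_bound_integral_interp_error {L r σ α : ℝ} (hL : 0 < L) (hr : 0 < r)
    (hσ₀ : 0 < σ) (hσ₁ : σ < 1) (hα₀ : 0 < α) (hα₁ : α < 1) :
    ∃ C, 0 ≤ C ∧ ∀ (K : ℝ) (G G' G'' E : ℝ → ℝ) (N : ℕ) (X : ℝ), 0 ≤ K → 1 ≤ N →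
      (r * (1 + σ - α) = 2 → 2 ≤ N) → X ∈ Icc (gradedNode L r N 1) (2 * L) →
      (G 0 = 0) → (∀ x ∈ Ioc 0 L, |G x| ≤ K * x ^ σ) →
      (∀ x ∈ Ioc 0 L, HasDerivAt G (G' x) x) → (∀ x ∈ Ioc 0 L, HasDerivAt G' (G'' x) x) →
      (∀ x ∈ Ioc 0 L, |G'' x| ≤ K * x ^ (σ - 2)) →
      (∀ j < N, ∀ y ∈ Icc (gradedNode L r N j) (gradedNode L r N (j + 1)),
        E y = G y - linInterp (gradedNode L r N j) (gradedNode L r N (j + 1))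
          (G (gradedNode L r N j)) (G (gradedNode L r N (j + 1))) y) →
      IntervalIntegrable (fun y => E y * |X - y| ^ (-α)) volume 0 L →
      |∫ y in (0 : ℝ)..L, E y * |X - y| ^ (-α)| ≤ K * C * spaceRate (r * (1 + σ - α)) N := by
  obtain ⟨C, hC, hrate⟩ := exists_bound_spaceRate (s := 1 + σ - α) hL hr
  set Q := 4 * (r * Real.exp r) ^ 2 * L ^ (2 / r) with hQ
  set p := σ - 2 / r with hp
  have h1α : 0 < 1 - α := by linarith
  -- The first summand is the first cell, the `Q` term all the others. The constant precedes the
  -- function and `X`, so it will serve all times and all collocation points.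
  refine ⟨4 / (1 - α) * C + Q * (2 ^ α * C + 2 ^ |p| * (2 / (1 - α)) * 2 ^ (1 - α) * C),
    by positivity, ?_⟩
  intro K G G' G'' E N X hK hN hN2 hX hG0 hGK hG hG' hG'' hE hint
  obtain ⟨r1, r2, r3⟩ := hrate N hN hN2
  set z := gradedNode L r N 1 with hz
  have hz0 : 0 < z := gradedNode_pos hL hN le_rfl
  have hzL : z ≤ L := by
    conv_rhs => rw [← gradedNode_self (L := L) (r := r) hN]
    exact (gradedNode_strictMono hL hr hN).monotone hN
  have hX0 : 0 < X := hz0.trans_le hX.1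
  have hsplit := intervalIntegral.integral_add_adjacent_intervals
    (hint.mono_set (by rw [uIcc_of_le hz0.le, uIcc_of_le hL.le]; exact Icc_subset_Icc_right hzL))
    (hint.mono_set (by rw [uIcc_of_le hzL, uIcc_of_le hL.le]; exact Icc_subset_Icc_left hz0.le))
  -- The second derivative may blow up at `0`, so the function and its interpolant are bounded
  -- separately by `K * z ^ σ`.
  have first : |∫ y in (0 : ℝ)..z, E y * |X - y| ^ (-α)| ≤
      (2 * K * z ^ σ) * (2 / (1 - α) * (z - 0) ^ (1 - α)) := by
    refine abs_integral_mul_kernel_le hα₀ hα₁ X hz0.le (by positivity) fun y hy => ?_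
    have hz00 : gradedNode L r N 0 = 0 := gradedNode_zero hr N
    have hEy := hE 0 (by omega) y (by rw [hz00]; exact ⟨hy.1.le, hy.2⟩)
    rw [hz00, zero_add, ← hz] at hEy
    have hGz := hGK z ⟨hz0, hzL⟩
    have hb : |linInterp 0 z (G 0) (G z) y| ≤ K * z ^ σ :=
      abs_linInterp_le hz0 ⟨hy.1.le, hy.2⟩ (by rw [hG0, abs_zero]; positivity) hGz
    have hGy : |G y| ≤ K * z ^ σ := (hGK y ⟨hy.1, hy.2.trans hzL⟩).trans (by
      gcongr
      · exact hy.1.le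
      · exact hy.2)
    rw [hEy]
    exact (abs_sub _ _).trans (by linarith)
  have second := abs_integral_mul_kernel_le_of_rpow (α := α) (p := p) (z := z) (L := L) (X := X)
    (B := K * Q * (N : ℝ) ^ (-2 : ℝ)) (E := E) hα₀ hα₁ hz0 hzL hX0 (by positivity) (fun y hy => by
      obtain ⟨j, hj1, hjN, hyj⟩ := exists_gradedNode_cell hN hy
      rw [hE j hjN y hyj]
      exact abs_sub_linInterp_gradedNode_le hL hr hσ₀ hσ₁ hN hj1 hjN hK hG hG' hG'' hyj)
  rw [← hsplit]
  refine (abs_add_le _ _).trans ((add_le_add first second).trans ?_)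
  have e1 : z ^ σ * z ^ (1 - α) = z ^ (1 + σ - α) := by rw [← Real.rpow_add hz0]; ring_nf
  have e2 : p - α = 1 + σ - α - 2 / r - 1 := by rw [hp]; ring
  have e3 : p + 1 - α = 1 + σ - α - 2 / r := by rw [hp]; ring
  rw [e2, e3, sub_zero]
  have r3' := r3 X hX
  calc _ = K * (4 / (1 - α)) * (z ^ σ * z ^ (1 - α)) +
        K * Q * (2 ^ α * ((N : ℝ) ^ (-2 : ℝ) * ∫ y in z..L, y ^ (1 + σ - α - 2 / r - 1)) +
          2 ^ |p| * (2 / (1 - α)) * 2 ^ (1 - α) *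
            ((N : ℝ) ^ (-2 : ℝ) * X ^ (1 + σ - α - 2 / r))) := by ring
    _ ≤ K * (4 / (1 - α)) * (C * spaceRate (r * (1 + σ - α)) N) +
        K * Q * (2 ^ α * (C * spaceRate (r * (1 + σ - α)) N) +
          2 ^ |p| * (2 / (1 - α)) * 2 ^ (1 - α) * (C * spaceRate (r * (1 + σ - α)) N)) := by
        rw [e1]; gcongr
    _ = _ := by ring

/-! ### The two-sided mesh -/

theorem node_of_le {a b r : ℝ} {N j : ℕ} (hj : j ≤ N) :
    node a b r N j = a + gradedNode ((b - a) / 2) r N j := by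
  rw [node, if_pos hj, gradedNode]

theorem node_of_ge {a b r : ℝ} {N j : ℕ} (hN : 1 ≤ N) (hj : N ≤ j) (hj2 : j ≤ 2 * N) :
    node a b r N j = b - gradedNode ((b - a) / 2) r N (2 * N - j) := by
  have hN0 : (N : ℝ) ≠ 0 := by positivity
  rcases hj.eq_or_lt with rfl | h
  · rw [node_of_le le_rfl, show 2 * N - N = N by omega, gradedNode_self hN]
    ring
  · rw [node, if_neg (not_le.2 h), gradedNode, Nat.cast_sub hj2]
    congr 3
    push_cast
    field_simp

theorem node_strictMonoOn {a b r : ℝ} {N : ℕ} (hab : a < b) (hr : 0 < r) (hN : 1 ≤ N) :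
    StrictMonoOn (node a b r N) (Iic (2 * N)) := by
  intro i hi j hj hij
  have hL : 0 < (b - a) / 2 := by linarith
  have hg := gradedNode_strictMono hL hr hN
  rw [mem_Iic] at hi hj
  rcases le_total j N with h | h
  · rw [node_of_le h, node_of_le (by omega)]
    linarith [hg hij]
  · rcases le_total N i with h' | h'
    · rw [node_of_ge hN h hj, node_of_ge hN h' hi]
      linarith [hg (show 2 * N - j < 2 * N - i by omega)]
    · rw [node_of_ge hN h hj, node_of_le h']
      have e1 := hg.monotone h'
      have e2 := hg.monotone (show 2 * N - j ≤ N by omega)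
      rw [gradedNode_self hN] at e1 e2
      rcases h'.eq_or_lt with h'' | h''
      · have e3 := hg (show 2 * N - j < N by omega)
        rw [gradedNode_self hN] at e3
        linarith
      · have e3 := hg h''
        rw [gradedNode_self hN] at e3
        linarith

theorem node_zero {a b r : ℝ} {N : ℕ} (hr : 0 < r) : node a b r N 0 = a := by
  rw [node_of_le (Nat.zero_le _), gradedNode_zero hr, add_zero]

theorem node_last {a b r : ℝ} {N : ℕ} (hr : 0 < r) (hN : 1 ≤ N) : node a b r N (2 * N) = b := by
  rw [node_of_ge hN (by omega) le_rfl, Nat.sub_self, gradedNode_zero hr, sub_zero]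

theorem node_mem_Ioo {a b r : ℝ} {N i : ℕ} (hab : a < b) (hr : 0 < r) (hN : 1 ≤ N) (hi : 1 ≤ i)
    (hi2 : i < 2 * N) : node a b r N i ∈ Ioo a b := by
  have h := node_strictMonoOn hab hr hN
  constructor
  · conv_lhs => rw [← node_zero (a := a) (b := b) (N := N) hr]
    exact h (mem_Iic.2 (Nat.zero_le _)) (mem_Iic.2 hi2.le) (by omega)
  · conv_rhs => rw [← node_last (a := a) (b := b) hr hN]
    exact h (mem_Iic.2 hi2.le) (mem_Iic.2 le_rfl) hi2

/-- Every point of a partitioned interval lies in some cell. -/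
theorem exists_cell {x : ℕ → ℝ} {n : ℕ} {y : ℝ} (hn : 1 ≤ n) (hy : y ∈ Icc (x 0) (x n)) :
    ∃ j < n, y ∈ Icc (x j) (x (j + 1)) := by
  classical
  have hlast : y ≤ x (n - 1 + 1) := by rw [Nat.sub_add_cancel hn]; exact hy.2
  have hex : ∃ m, y ≤ x (m + 1) := ⟨n - 1, hlast⟩
  have hle : Nat.find hex ≤ n - 1 := Nat.find_min' hex hlast
  refine ⟨Nat.find hex, by omega, ?_, Nat.find_spec hex⟩
  rcases Nat.eq_zero_or_pos (Nat.find hex) with h0 | hpos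
  · rw [h0]; exact hy.1
  · have := Nat.find_min hex (m := Nat.find hex - 1) (by omega)
    rw [Nat.sub_add_cancel hpos] at this
    exact (not_le.1 this).le

/-! ### Hat functions and the piecewise linear interpolant -/

theorem hat_nonneg (x : ℕ → ℝ) (k : ℕ) (y : ℝ) : 0 ≤ hat x k y := by
  unfold hat
  split_ifs with h1 h2
  · exact div_nonneg (by linarith [h1.1]) (by linarith [h1.1, h1.2])
  · exact div_nonneg (by linarith [h2.2]) (by linarith [h2.1, h2.2])
  · exact le_rfl

theorem hat_le_one (x : ℕ → ℝ) (k : ℕ) (y : ℝ) : hat x k y ≤ 1 := by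
  unfold hat
  split_ifs with h1 h2
  · exact div_le_one_of_le₀ (by linarith [h1.2]) (by linarith [h1.1, h1.2])
  · exact div_le_one_of_le₀ (by linarith [h2.1]) (by linarith [h2.1, h2.2])
  · exact zero_le_one

theorem measurable_hat (x : ℕ → ℝ) (k : ℕ) : Measurable (hat x k) := by
  unfold hat
  refine Measurable.ite measurableSet_Icc (by fun_prop) ?_
  exact Measurable.ite measurableSet_Icc (by fun_prop) measurable_const

/-- On a cell only the hats of its two end nodes survive. The form with two indicators of `k` lets a
sum over `k` collapse. -/
theorem hat_eq_of_mem_cell {x : ℕ → ℝ} {n k j : ℕ} {y : ℝ} (hx : StrictMonoOn x (Iic n))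
    (hk : 1 ≤ k) (hkn : k < n) (hj : j < n) (hy : y ∈ Icc (x j) (x (j + 1))) :
    hat x k y = (if k = j + 1 then (y - x j) / (x (j + 1) - x j) else 0) +
      (if k = j then (x (j + 1) - y) / (x (j + 1) - x j) else 0) := by
  have lt : ∀ i l, i < l → l ≤ n → x i < x l := fun i l h h' =>
    hx (mem_Iic.2 (by omega)) (mem_Iic.2 h') h
  have le : ∀ i l, i ≤ l → l ≤ n → x i ≤ x l := fun i l h h' =>
    hx.monotoneOn (mem_Iic.2 (by omega)) (mem_Iic.2 h') h
  unfold hat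
  rcases lt_trichotomy k (j + 1) with h | h | h
  · rw [if_neg h.ne, zero_add]
    rcases (Nat.lt_succ_iff.1 h).eq_or_lt with h' | h'
    · subst h'
      rw [if_pos rfl]
      split_ifs with h1
      · have : y = x k := le_antisymm h1.2 hy.1
        have := lt (k - 1) k (by omega) hkn.le
        have := lt k (k + 1) (by omega) hkn
        subst y
        rw [div_self (by linarith), div_self (by linarith)]
      · rfl
    · rw [if_neg h'.ne]
      have h3 := le (k + 1) j h' hj.le
      have h4 := lt k (k + 1) (by omega) hkn
      rw [if_neg (fun h1 => by linarith [h1.2, hy.1])]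
      split_ifs with h2
      · have : y = x (k + 1) := le_antisymm h2.2 (h3.trans hy.1)
        rw [this, sub_self, zero_div]
      · rfl
  · subst h
    rw [Nat.add_sub_cancel, if_pos hy, if_pos rfl, if_neg (Nat.succ_ne_self j), add_zero]
  · rw [if_neg h.ne', if_neg (show k ≠ j by omega), add_zero]
    have h3 := le (j + 1) (k - 1) (by omega) (by omega)
    have h4 := lt (k - 1) k (by omega) hkn.le
    split_ifs with h1 h2
    · have : y = x (k - 1) := le_antisymm (hy.2.trans h3) h1.1
      rw [this, sub_self, zero_div]
    · exact absurd h2.1 (by linarith [hy.2])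
    · rfl

theorem hat_node {x : ℕ → ℝ} {n k i : ℕ} (hx : StrictMonoOn x (Iic n)) (hk : 1 ≤ k) (hkn : k < n)
    (hi : i < n) : hat x k (x i) = if k = i then 1 else 0 := by
  have h := hx (mem_Iic.2 hi.le) (mem_Iic.2 hi) (Nat.lt_succ_self i)
  rw [hat_eq_of_mem_cell hx hk hkn hi ⟨le_rfl, h.le⟩, sub_self, zero_div, ite_self, zero_add,
    div_self (sub_pos.2 h).ne']

/-- The piecewise linear function with nodal values `w` that vanishes at both ends. -/
noncomputable def interp (x : ℕ → ℝ) (n : ℕ) (w : ℕ → ℝ) (y : ℝ) : ℝ :=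
  ∑ k : Fin (n - 1), w (k + 1) * hat x (k + 1) y

theorem interp_eq_linInterp {x w : ℕ → ℝ} {n j : ℕ} {y : ℝ} (hx : StrictMonoOn x (Iic n))
    (hn : 1 ≤ n) (hw0 : w 0 = 0) (hwn : w n = 0) (hj : j < n)
    (hy : y ∈ Icc (x j) (x (j + 1))) :
    interp x n w y = linInterp (x j) (x (j + 1)) (w j) (w (j + 1)) y := by
  -- The sum is extended to all indices `0, …, n`, so cells touching the boundary need no separate
  -- treatment; the added terms vanish because `w 0 = w n = 0`.
  set H : ℕ → ℝ := fun k => (if k = j + 1 then w k * ((y - x j) / (x (j + 1) - x j)) else 0) +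
      (if k = j then w k * ((x (j + 1) - y) / (x (j + 1) - x j)) else 0) with hH
  have hterm : ∀ k : Fin (n - 1), w (k + 1) * hat x (k + 1) y = H (k + 1) := by
    intro k
    rw [hat_eq_of_mem_cell hx (by omega) (by omega) hj hy, hH]
    simp only [mul_add, mul_ite, mul_zero]
  have hsum : ∑ k ∈ Finset.range (n + 1), H k = interp x n w y := by
    have hH0 : H 0 = 0 := by simp only [hH, hw0, zero_mul, ite_self, add_zero]
    have hHn : H n = 0 := by simp only [hH, hwn, zero_mul, ite_self, add_zero]
    obtain ⟨m, rfl⟩ := Nat.exists_eq_add_of_le' hn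
    rw [Finset.sum_range_succ, hHn, add_zero, Finset.sum_range_succ', hH0, add_zero, interp,
      Finset.sum_congr rfl (fun k _ => hterm k)]
    exact (Fin.sum_univ_eq_sum_range (fun k => H (k + 1)) m).symm
  rw [← hsum, hH, Finset.sum_add_distrib, Finset.sum_ite_eq', Finset.sum_ite_eq',
    if_pos (Finset.mem_range.2 (by omega)), if_pos (Finset.mem_range.2 (by omega)), linInterp,
    add_comm]

theorem interp_node {x w : ℕ → ℝ} {n i : ℕ} (hx : StrictMonoOn x (Iic n)) (hi : 1 ≤ i)
    (hin : i < n) : interp x n w (x i) = w i := by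
  unfold interp
  rw [Finset.sum_eq_single (⟨i - 1, by omega⟩ : Fin (n - 1))]
  · rw [hat_node hx (by omega) (by simp; omega) hin]
    simp [Nat.sub_add_cancel hi]
  · intro k _ hk
    rw [hat_node hx (by omega) (by omega) hin, if_neg, mul_zero]
    intro h
    exact hk (Fin.ext (by simp; omega))
  · simp

theorem measurable_interp (x : ℕ → ℝ) (n : ℕ) (w : ℕ → ℝ) : Measurable (interp x n w) := by
  unfold interp
  exact Finset.measurable_fun_sum _ fun k _ => (measurable_hat x _).const_mul _

theorem abs_interp_le {x w : ℕ → ℝ} {n : ℕ} {y B : ℝ} (hx : StrictMonoOn x (Iic n))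
    (hn : 1 ≤ n) (hw0 : w 0 = 0) (hwn : w n = 0) (hw : ∀ k ≤ n, |w k| ≤ B)
    (hy : y ∈ Icc (x 0) (x n)) : |interp x n w y| ≤ B := by
  obtain ⟨j, hj, hyj⟩ := exists_cell hn hy
  rw [interp_eq_linInterp hx hn hw0 hwn hj hyj]
  exact abs_linInterp_le (hx (mem_Iic.2 hj.le) (mem_Iic.2 hj) (Nat.lt_succ_self j)) hyj
    (hw j hj.le) (hw (j + 1) hj)

/-! ### Sign and size of the collocation matrix -/

theorem div_abs_rpow_eq (v z α : ℝ) : v / |z| ^ α = v * |z| ^ (-α) := by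
  rw [Real.rpow_neg (abs_nonneg z), div_eq_mul_inv]

theorem coeff_intervalIntegrable {a b α : ℝ} (hab : a < b) (hα : α < 1) (x : ℕ → ℝ) (k : ℕ)
    (v z : ℝ) :
    IntervalIntegrable (fun y => (v - hat x k y) * |z - y| ^ (-α)) volume a b := by
  refine intervalIntegrable_mul_kernel (B := |v| + 1) hα z hab.le
    (measurable_const.sub (measurable_hat x k)).aestronglyMeasurable fun y _ => ?_
  refine (abs_sub _ _).trans (add_le_add le_rfl ?_)
  rw [abs_of_nonneg (hat_nonneg x k y)]
  exact hat_le_one x k y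

theorem coeff_eq (a b α r : ℝ) (N i k : ℕ) :
    coeff a b α r N i k = ∫ y in a..b,
      (hat (node a b r N) k (node a b r N i) - hat (node a b r N) k y) *
        |node a b r N i - y| ^ (-α) := by
  simp only [coeff, div_abs_rpow_eq]

/-- The collocation matrix applied to nodal values is minus the nonlocal operator applied to the
interpolant. -/
theorem stiffness_mulVec {a b α r : ℝ} {N : ℕ} (hab : a < b) (hα : α < 1) (w : ℕ → ℝ)
    (i : Fin (2 * N - 1)) :
    (stiffness a b α r N).mulVec (fun k => w (k + 1)) i =
      ∫ y in a..b, (interp (node a b r N) (2 * N) w (node a b r N (i + 1)) -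
        interp (node a b r N) (2 * N) w y) * |node a b r N (i + 1) - y| ^ (-α) := by
  simp only [Matrix.mulVec, dotProduct, stiffness, Matrix.of_apply, coeff_eq]
  simp_rw [← intervalIntegral.integral_mul_const]
  rw [← intervalIntegral.integral_finsetSum]
  · congr 1
    ext y
    rw [interp, interp, ← Finset.sum_sub_distrib, Finset.sum_mul]
    exact Finset.sum_congr rfl fun k _ => by ring
  · intro k _
    exact (coeff_intervalIntegrable hab hα _ _ _ _).mul_const _

/-- Off the diagonal `φ_k(x_i) = 0`, so the integrand is `-φ_k` times a nonnegative kernel. -/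
theorem coeff_nonpos {a b α r : ℝ} {N i k : ℕ} (hab : a < b) (hr : 0 < r) (hN : 1 ≤ N)
    (hi : i < 2 * N) (hk : 1 ≤ k) (hkN : k < 2 * N) (hik : k ≠ i) :
    coeff a b α r N i k ≤ 0 := by
  rw [coeff_eq, hat_node (node_strictMonoOn hab hr hN) hk hkN hi, if_neg hik]
  rw [← neg_nonneg, ← intervalIntegral.integral_neg]
  refine intervalIntegral.integral_nonneg hab.le fun y _ => ?_
  rw [zero_sub, neg_mul, neg_neg]
  exact mul_nonneg (hat_nonneg _ _ _) (Real.rpow_nonneg (abs_nonneg _) _)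

/-- Since `0 ≤ 1 - φ_i ≤ 1`, the entry is at most the integral of the kernel over `[a, b]`, whatever
the mesh. -/
theorem coeff_self_le {a b α r : ℝ} {N i : ℕ} (hab : a < b) (hα₀ : 0 < α) (hα : α < 1)
    (hr : 0 < r) (hN : 1 ≤ N) (hi1 : 1 ≤ i) (hi : i < 2 * N) :
    coeff a b α r N i i ≤ 2 / (1 - α) * (b - a) ^ (1 - α) := by
  rw [coeff_eq, hat_node (node_strictMonoOn hab hr hN) hi1 hi hi, if_pos rfl]
  refine (le_abs_self _).trans ?_
  rw [← one_mul (2 / (1 - α) * (b - a) ^ (1 - α))]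
  refine abs_integral_mul_kernel_le hα₀ hα _ hab.le zero_le_one fun y _ => ?_
  rw [abs_of_nonneg (by linarith [hat_le_one (node a b r N) i y])]
  linarith [hat_nonneg (node a b r N) i y]

/-- The row sum is `A` applied to the vector of ones. Its interpolant, cut down to zero at both
ends, equals `1` at `x_i` and never exceeds `1`. -/
theorem stiffness_row_sum_nonneg {a b α r : ℝ} {N : ℕ} (hab : a < b) (hα : α < 1)
    (hr : 0 < r) (hN : 1 ≤ N) (i : Fin (2 * N - 1)) : 0 ≤ ∑ k, stiffness a b α r N i k := by
  set w : ℕ → ℝ := fun k => if 1 ≤ k ∧ k < 2 * N then 1 else 0 with hw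
  have h := stiffness_mulVec (r := r) hab hα w i
  have hsum : (stiffness a b α r N).mulVec (fun k => w (k + 1)) i =
      ∑ k, stiffness a b α r N i k := by
    simp only [Matrix.mulVec, dotProduct]
    refine Finset.sum_congr rfl fun k _ => ?_
    have : w (k + 1) = 1 := by rw [hw]; exact if_pos ⟨by omega, by omega⟩
    rw [this, mul_one]
  rw [← hsum, h]
  have hmono := node_strictMonoOn (r := r) hab hr hN
  have hwi : w (i + 1) = 1 := by rw [hw]; exact if_pos ⟨by omega, by omega⟩
  refine intervalIntegral.integral_nonneg hab.le fun y hy => ?_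
  refine mul_nonneg ?_ (Real.rpow_nonneg (abs_nonneg _) _)
  rw [interp_node hmono (by omega) (by omega), hwi]
  have hb : |interp (node a b r N) (2 * N) w y| ≤ 1 := by
    refine abs_interp_le hmono (by omega) (by simp [hw]) (by simp [hw]) (fun k _ => ?_)
      (by rwa [node_zero hr, node_last hr hN])
    rw [hw]
    dsimp only
    split_ifs <;> simp
  linarith [(abs_le.1 hb).2]

/-! ### Maximum norm stability of the time stepping -/

section Stability

variable {ι : Type*} [Fintype ι] [DecidableEq ι]

/-- Discrete maximum principle: at an index `m` where `|v|` is largest, with `s` a sign of `v m`,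
the sign conditions give `s * (A v) m ≥ |v m| * ∑ k, A m k ≥ 0`. -/
theorem abs_le_of_abs_one_add_mulVec_le {A : Matrix ι ι ℝ} {c B : ℝ} {v : ι → ℝ} (hc : 0 ≤ c)
    (hoff : ∀ i k, i ≠ k → A i k ≤ 0) (hrow : ∀ i, 0 ≤ ∑ k, A i k)
    (hB : ∀ i, |(1 + c • A).mulVec v i| ≤ B) (i : ι) : |v i| ≤ B := by
  obtain ⟨m, -, hm⟩ := Finset.exists_max_image Finset.univ (fun i => |v i|) ⟨i, Finset.mem_univ i⟩
  refine (hm i (Finset.mem_univ i)).trans (le_trans ?_ (hB m))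
  have e : (1 + c • A).mulVec v m = v m + c * ∑ k, A m k * v k := by
    rw [Matrix.add_mulVec, Matrix.one_mulVec, Matrix.smul_mulVec]
    rfl
  have key : ∀ s : ℝ, |s| = 1 → s * v m = |v m| → |v m| ≤ |(1 + c • A).mulVec v m| := by
    intro s hs hsv
    have h1 : ∑ k, A m k * |v m| ≤ ∑ k, A m k * (s * v k) := by
      refine Finset.sum_le_sum fun k _ => ?_
      by_cases hk : m = k
      · rw [← hk, hsv]
      · refine mul_le_mul_of_nonpos_left ?_ (hoff m k hk)
        refine (le_abs_self _).trans ?_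
        rw [abs_mul, hs, one_mul]
        exact hm k (Finset.mem_univ k)
    rw [← Finset.sum_mul] at h1
    have h2 : 0 ≤ ∑ k, A m k * (s * v k) := (mul_nonneg (hrow m) (abs_nonneg _)).trans h1
    have h3 : s * (1 + c • A).mulVec v m = |v m| + c * ∑ k, A m k * (s * v k) := by
      rw [e, mul_add, hsv, mul_left_comm, Finset.mul_sum]
      congr 2
      exact Finset.sum_congr rfl fun k _ => by ring
    have h4 : s * (1 + c • A).mulVec v m ≤ |(1 + c • A).mulVec v m| := by
      refine (le_abs_self _).trans ?_
      rw [abs_mul, hs, one_mul]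
    have := mul_nonneg hc h2
    linarith
  rcases le_total 0 (v m) with h | h
  · exact key 1 (by simp) (by rw [one_mul, abs_of_nonneg h])
  · exact key (-1) (by simp) (by rw [abs_of_nonpos h]; ring)

/-- Nonnegative row sums make the off-diagonal absolute sum at most the diagonal entry, so the
absolute row sum is at most `2 * D`. -/
theorem abs_one_sub_mulVec_le {A : Matrix ι ι ℝ} {c B D : ℝ} {v : ι → ℝ} (hc : 0 ≤ c)
    (hoff : ∀ i k, i ≠ k → A i k ≤ 0) (hrow : ∀ i, 0 ≤ ∑ k, A i k) (hdiag : ∀ i, A i i ≤ D)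
    (hB : ∀ i, |v i| ≤ B) (i : ι) : |(1 - c • A).mulVec v i| ≤ (1 + 2 * c * D) * B := by
  have hB0 : 0 ≤ B := (abs_nonneg _).trans (hB i)
  have e : (1 - c • A).mulVec v i = v i - c * ∑ k, A i k * v k := by
    rw [Matrix.sub_mulVec, Matrix.one_mulVec, Matrix.smul_mulVec]
    rfl
  have hsplit : ∑ k, A i k = A i i + ∑ k ∈ Finset.univ.erase i, A i k :=
    (Finset.add_sum_erase _ _ (Finset.mem_univ i)).symm
  have hneg : ∑ k ∈ Finset.univ.erase i, A i k ≤ 0 :=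
    Finset.sum_nonpos fun k hk => hoff i k (Finset.ne_of_mem_erase hk).symm
  have hii : 0 ≤ A i i := by linarith [hrow i]
  have habs : ∑ k, |A i k| ≤ 2 * D := by
    rw [← Finset.add_sum_erase _ _ (Finset.mem_univ i), abs_of_nonneg hii]
    have : ∑ k ∈ Finset.univ.erase i, |A i k| = -∑ k ∈ Finset.univ.erase i, A i k := by
      rw [← Finset.sum_neg_distrib]
      exact Finset.sum_congr rfl fun k hk =>
        abs_of_nonpos (hoff i k (Finset.ne_of_mem_erase hk).symm)
    rw [this]
    linarith [hrow i, hdiag i]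
  have hsum : |∑ k, A i k * v k| ≤ 2 * D * B := by
    calc _ ≤ ∑ k, |A i k * v k| := Finset.abs_sum_le_sum_abs _ _
      _ ≤ ∑ k, |A i k| * B := Finset.sum_le_sum fun k _ => by
          rw [abs_mul]; exact mul_le_mul_of_nonneg_left (hB k) (abs_nonneg _)
      _ ≤ _ := by rw [← Finset.sum_mul]; exact mul_le_mul_of_nonneg_right habs hB0
  rw [e]
  refine (abs_sub _ _).trans ?_
  rw [abs_mul, abs_of_nonneg hc]
  have := mul_le_mul_of_nonneg_left hsum hc
  linarith [hB i]

/-- Maximum norm stability of the Crank–Nicolson scheme for a diagonally dominant matrix with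
nonpositive off-diagonal entries and bounded diagonal. -/
theorem crankNicolson_stable {A : Matrix ι ι ℝ} {D ρ : ℝ} {M : ℕ} {e R : ℕ → ι → ℝ}
    (hM : 1 ≤ M) (hD : 0 ≤ D) (hρ : 0 ≤ ρ)
    (hoff : ∀ i k, i ≠ k → A i k ≤ 0) (hrow : ∀ i, 0 ≤ ∑ k, A i k) (hdiag : ∀ i, A i i ≤ D)
    (he0 : ∀ i, e 0 i = 0)
    (hstep : ∀ j : ℕ, 1 ≤ j → j ≤ M → (1 + (1 / (M : ℝ) / 2) • A).mulVec (e j) =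
      (1 - (1 / (M : ℝ) / 2) • A).mulVec (e (j - 1)) + (1 / (M : ℝ)) • R j)
    (hR : ∀ j : ℕ, 1 ≤ j → j ≤ M → ∀ i, |R j i| ≤ ρ) (k : ℕ) (hk : k ≤ M) (i : ι) :
    |e k i| ≤ Real.exp D * ρ := by
  have hM' : (0 : ℝ) < M := by positivity
  set τ := 1 / (M : ℝ) with hτ
  have hτ0 : 0 < τ := by positivity
  -- Discrete Gronwall: `k` residuals of size `τ * ρ` are each amplified at most `k` times. Then `k
  -- * τ ≤ 1` makes the bound uniform.
  have hind : ∀ k : ℕ, k ≤ M → ∀ i, |e k i| ≤ (1 + τ * D) ^ k * (k * τ * ρ) := by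
    intro k
    induction k with
    | zero => intro _ i; simp [he0 i]
    | succ k ih =>
      intro hk
      have ih' := ih (by omega)
      refine abs_le_of_abs_one_add_mulVec_le (c := τ / 2) (by positivity) hoff hrow fun i => ?_
      rw [hstep (k + 1) (by omega) hk, Nat.add_sub_cancel, Pi.add_apply, Pi.smul_apply, smul_eq_mul]
      refine (abs_add_le _ _).trans ?_
      have h1 := abs_one_sub_mulVec_le (c := τ / 2) (by positivity) hoff hrow hdiag ih' i
      have h2 : |τ * R (k + 1) i| ≤ τ * ρ := by
        rw [abs_mul, abs_of_pos hτ0]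
        exact mul_le_mul_of_nonneg_left (hR (k + 1) (by omega) hk i) hτ0.le
      have h3 : 1 * (τ * ρ) ≤ (1 + τ * D) ^ (k + 1) * (τ * ρ) := by
        refine mul_le_mul_of_nonneg_right (one_le_pow₀ ?_) (by positivity)
        have : 0 ≤ τ * D := by positivity
        linarith
      calc _ ≤ (1 + 2 * (τ / 2) * D) * ((1 + τ * D) ^ k * (k * τ * ρ)) + 1 * (τ * ρ) := by
            linarith
        _ ≤ (1 + 2 * (τ / 2) * D) * ((1 + τ * D) ^ k * (k * τ * ρ)) +
            (1 + τ * D) ^ (k + 1) * (τ * ρ) := by linarith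
        _ = _ := by push_cast; ring
  refine (hind k hk i).trans ?_
  have hkτ : (k : ℝ) * τ ≤ 1 := by
    rw [hτ, mul_one_div, div_le_one hM']; exact_mod_cast hk
  have h1 : (1 + τ * D) ^ k ≤ Real.exp D := by
    calc (1 + τ * D) ^ k ≤ Real.exp (τ * D) ^ k := by
          refine pow_le_pow_left₀ (by positivity) ?_ k
          rw [add_comm]; exact Real.add_one_le_exp _
      _ = Real.exp (k * τ * D) := by rw [← Real.exp_nat_mul]; ring_nf
      _ ≤ Real.exp D := Real.exp_le_exp.2 (by nlinarith)
  calc _ ≤ Real.exp D * (1 * ρ) := by gcongr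
    _ = _ := by ring

end Stability

/-! ### Taylor estimates in time -/

/-- One rung of a Taylor ladder: the mean value inequality between `t` and `s` raises the order of
vanishing by one. Factorials are given up. -/
theorem abs_le_pow_succ_of_hasDerivWithinAt {F F' : ℝ → ℝ} {S : Set ℝ} {t s C : ℝ} {n : ℕ}
    (hS : Convex ℝ S) (ht : t ∈ S) (hs : s ∈ S) (hC : 0 ≤ C) (hFt : F t = 0)
    (hF : ∀ x ∈ S, HasDerivWithinAt F (F' x) S x) (hF' : ∀ x ∈ S, |F' x| ≤ C * |x - t| ^ n) :
    |F s| ≤ C * |s - t| ^ (n + 1) := by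
  have hsub : uIcc t s ⊆ S := hS.ordConnected.uIcc_subset ht hs
  have h := Convex.norm_image_sub_le_of_norm_hasDerivWithin_le (C := C * |s - t| ^ n)
    (fun x hx => (hF x (hsub hx)).mono hsub) (fun x hx => (hF' x (hsub hx)).trans (by
      gcongr C * ?_ ^ n
      exact abs_sub_left_of_mem_uIcc hx)) (convex_uIcc t s) left_mem_uIcc right_mem_uIcc
  rw [hFt, sub_zero, Real.norm_eq_abs, Real.norm_eq_abs] at h
  exact h.trans_eq (by ring)

theorem hasDerivWithinAt_iteratedDerivWithin {g : ℝ → ℝ} {S : Set ℝ} {n m : ℕ}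
    (hS : UniqueDiffOn ℝ S) (hg : ContDiffOn ℝ n g S) (hm : m < n) {x : ℝ} (hx : x ∈ S) :
    HasDerivWithinAt (iteratedDerivWithin m g S) (iteratedDerivWithin (m + 1) g S x) S x := by
  rw [iteratedDerivWithin_succ]
  exact ((hg.differentiableOn_iteratedDerivWithin (by exact_mod_cast hm) hS) x hx).hasDerivWithinAt

/-- Central differences of a function on `[0, 1]` that is bounded together with its third
derivative. -/
theorem central_difference_bounds {g : ℝ → ℝ} {K₀ K₃ t h : ℝ}
    (hg : ContDiffOn ℝ 3 g (Icc (0 : ℝ) 1)) (h0 : ∀ s ∈ Icc (0 : ℝ) 1, |g s| ≤ K₀)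
    (h3 : ∀ s ∈ Icc (0 : ℝ) 1, |iteratedDerivWithin 3 g (Icc (0 : ℝ) 1) s| ≤ K₃)
    (ht : t ∈ Icc (0 : ℝ) 1) (hh : 0 ≤ h) (hm : t - h ∈ Icc (0 : ℝ) 1)
    (hp : t + h ∈ Icc (0 : ℝ) 1) :
    |g (t + h) - g (t - h) - 2 * h * derivWithin g (Icc (0 : ℝ) 1) t| ≤ 2 * K₃ * h ^ 3 ∧
    |g t - (g (t + h) + g (t - h)) / 2| ≤ (16 * K₀ + 2 * K₃) * h ^ 2 := by
  set S := Icc (0 : ℝ) 1 with hS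
  have hconv : Convex ℝ S := convex_Icc 0 1
  have hU : UniqueDiffOn ℝ S := uniqueDiffOn_Icc zero_lt_one
  set g1 := iteratedDerivWithin 1 g S with hg1
  set g2 := iteratedDerivWithin 2 g S with hg2
  have d0 : ∀ x ∈ S, HasDerivWithinAt g (g1 x) S x := fun x hx => by
    have := hasDerivWithinAt_iteratedDerivWithin (n := 3) (m := 0) hU hg (by norm_num) hx
    rwa [iteratedDerivWithin_zero] at this
  have d1 : ∀ x ∈ S, HasDerivWithinAt g1 (g2 x) S x := fun x hx =>
    hasDerivWithinAt_iteratedDerivWithin (n := 3) (m := 1) hU hg (by norm_num) hx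
  have d2 : ∀ x ∈ S, HasDerivWithinAt g2 (iteratedDerivWithin 3 g S x) S x := fun x hx =>
    hasDerivWithinAt_iteratedDerivWithin (n := 3) (m := 2) hU hg (by norm_num) hx
  have hK3 : 0 ≤ K₃ := (abs_nonneg _).trans (h3 t ht)
  have hK0 : 0 ≤ K₀ := (abs_nonneg _).trans (h0 t ht)
  have lin : ∀ c t x : ℝ, HasDerivWithinAt (fun y => c * (y - t)) c S x := fun c t x => by
    simpa using (((hasDerivAt_id x).sub_const t).const_mul c).hasDerivWithinAt (s := S)
  have taylor2 : ∀ t ∈ S, ∀ s ∈ S, |g2 s - g2 t| ≤ K₃ * |s - t| ^ (0 + 1) := by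
    intro t ht s hs
    refine abs_le_pow_succ_of_hasDerivWithinAt (F := fun s => g2 s - g2 t) hconv ht hs hK3
      (sub_self _) (fun x hx => (d2 x hx).sub_const _) fun x hx => ?_
    simpa using h3 x hx
  have taylor1 : ∀ t ∈ S, ∀ s ∈ S, |g1 s - g1 t - g2 t * (s - t)| ≤ K₃ * |s - t| ^ (1 + 1) := by
    intro t ht s hs
    exact abs_le_pow_succ_of_hasDerivWithinAt (F := fun s => g1 s - g1 t - g2 t * (s - t))
      hconv ht hs hK3 (by simp) (fun x hx => ((d1 x hx).sub_const _).sub (lin _ _ x))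
      (taylor2 t ht)
  have taylor0 : ∀ t ∈ S, ∀ s ∈ S,
      |g s - g t - g1 t * (s - t) - g2 t / 2 * (s - t) ^ 2| ≤ K₃ * |s - t| ^ (2 + 1) := by
    intro t ht s hs
    refine abs_le_pow_succ_of_hasDerivWithinAt
      (F := fun s => g s - g t - g1 t * (s - t) - g2 t / 2 * (s - t) ^ 2)
      hconv ht hs hK3 (by simp) (fun x hx => ?_) (taylor1 t ht)
    refine (((d0 x hx).sub_const _).sub (lin _ _ x)).sub ?_
    have := ((((hasDerivAt_id x).sub_const t).pow 2).const_mul (g2 t / 2)).hasDerivWithinAt (s := S)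
    refine this.congr_deriv ?_
    simp
    ring
  -- Adding the expansions about `1/2` at `0` and `1` cancels `g1`, so `|g2 (1/2)| ≤ 16 * K₀ + K₃`;
  -- moving to `s` costs another `K₃`.
  have hg2b : ∀ s ∈ S, |g2 s| ≤ 16 * K₀ + 2 * K₃ := by
    intro s hs
    have hhalf : (1 / 2 : ℝ) ∈ S := ⟨by norm_num, by norm_num⟩
    have hz : (0 : ℝ) ∈ S := ⟨by norm_num, by norm_num⟩
    have ho : (1 : ℝ) ∈ S := ⟨by norm_num, by norm_num⟩
    have e1 := taylor0 _ hhalf _ ho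
    have e2 := taylor0 _ hhalf _ hz
    have e3 := taylor2 _ hhalf _ hs
    have e4 : |s - 1 / 2| ≤ 1 := by
      rw [abs_le]; constructor <;> linarith [hs.1, hs.2]
    rw [zero_add, pow_one] at e3
    have e5 := e3.trans (mul_le_mul_of_nonneg_left e4 hK3)
    norm_num [abs_of_nonneg, abs_of_nonpos] at e1 e2
    have b0 := abs_le.1 (h0 _ hz)
    have b1 := abs_le.1 (h0 _ ho)
    have b2 := abs_le.1 (h0 _ hhalf)
    have c1 := abs_le.1 e1
    have c2 := abs_le.1 e2
    have c3 := abs_le.1 e5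
    rw [abs_le]
    norm_num at b2 c3
    constructor <;> linarith [b0.1, b0.2, b1.1, b1.2, b2.1, b2.2, c1.1, c1.2, c2.1, c2.2, c3.1, c3.2]
  have first : ∀ s ∈ S, |g s - g t - g1 t * (s - t)| ≤ (16 * K₀ + 2 * K₃) * |s - t| ^ (1 + 1) := by
    intro s hs
    refine abs_le_pow_succ_of_hasDerivWithinAt (F := fun s => g s - g t - g1 t * (s - t))
      hconv ht hs (by positivity) (by simp)
      (fun x hx => ((d0 x hx).sub_const _).sub (lin _ _ x)) fun x hx => ?_
    have := abs_le_pow_succ_of_hasDerivWithinAt (F := fun s => g1 s - g1 t) (n := 0)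
      hconv ht hx (C := 16 * K₀ + 2 * K₃) (by positivity) (sub_self _)
      (fun x hx => (d1 x hx).sub_const _) (fun x hx => by simpa using hg2b x hx)
    simpa using this
  have hg1t : derivWithin g S t = g1 t := by rw [hg1, iteratedDerivWithin_one]
  rw [hg1t]
  constructor
  · have e1 := abs_le.1 (taylor0 t ht _ hp)
    have e2 := abs_le.1 (taylor0 t ht _ hm)
    have f1 : t + h - t = h := by ring
    have f2 : t - h - t = -h := by ring
    rw [f1, abs_of_nonneg hh] at e1
    rw [f2, abs_neg, abs_of_nonneg hh] at e2
    norm_num at e1 e2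
    rw [abs_le]
    constructor <;> linarith [e1.1, e1.2, e2.1, e2.2]
  · have e1 := abs_le.1 (first _ hp)
    have e2 := abs_le.1 (first _ hm)
    have f1 : t + h - t = h := by ring
    have f2 : t - h - t = -h := by ring
    rw [f1, abs_of_nonneg hh] at e1
    rw [f2, abs_neg, abs_of_nonneg hh] at e2
    norm_num at e1 e2
    rw [abs_le]
    constructor <;> linarith [e1.1, e1.2, e2.1, e2.2]

/-! ### Consistency in space -/

theorem linInterp_add_left (c d v w y s : ℝ) :
    linInterp (s + c) (s + d) v w (s + y) = linInterp c d v w y := by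
  simp only [linInterp, add_sub_add_left_eq_sub]

theorem linInterp_sub_left (c d v w y s : ℝ) :
    linInterp (s - d) (s - c) w v (s - y) = linInterp c d v w y := by
  simp only [linInterp, sub_sub_sub_cancel_left]
  ring

theorem aestronglyMeasurable_of_continuousOn_Ioo {a b : ℝ} {v : ℝ → ℝ}
    (hv : ContinuousOn v (Ioo a b)) : AEStronglyMeasurable v (volume.restrict (Ioc a b)) := by
  rw [← Measure.restrict_congr_set (Ioo_ae_eq_Ioc (μ := volume))]
  exact hv.aestronglyMeasurable measurableSet_Ioo

/-- Consistency of collocation in space: the interpolation error on the graded mesh integrated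
against the kernel. -/
theorem exists_bound_space_truncation {a b α σ r : ℝ} (hab : a < b) (hα₀ : 0 < α) (hα₁ : α < 1)
    (hσ₀ : 0 < σ) (hσ₁ : σ < 1) (hr : 0 < r) :
    ∃ C, 0 ≤ C ∧ ∀ (K : ℝ) (v : ℝ → ℝ), 0 ≤ K → ContDiffOn ℝ 2 v (Ioo a b) → v a = 0 → v b = 0 →
      (∀ x ∈ Ioo a b, |v x| ≤ K * ((x - a) * (b - x)) ^ σ) →
      (∀ x ∈ Ioo a b, |iteratedDeriv 2 v x| ≤ K * ((x - a) * (b - x)) ^ (σ - 2)) →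
      ∀ N : ℕ, 1 ≤ N → (r * (1 + σ - α) = 2 → 2 ≤ N) → ∀ i, 1 ≤ i → i < 2 * N →
        |∫ y in a..b, (v y - interp (node a b r N) (2 * N) (fun k => v (node a b r N k)) y) *
          |node a b r N i - y| ^ (-α)| ≤ K * C * spaceRate (r * (1 + σ - α)) N := by
  set L := (b - a) / 2 with hLdef
  have hL : 0 < L := by rw [hLdef]; linarith
  obtain ⟨C, hC, hhalf⟩ := exists_bound_integral_interp_error hL hr hσ₀ hσ₁ hα₀ hα₁
  -- On either half the distance to the far endpoint lies between `L` and `2 * L`, so its power is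
  -- absorbed in `Q` and only the near singularity remains.
  set Q := (2 * L) ^ σ + L ^ (σ - 2) with hQ
  have hQ1 : (2 * L) ^ σ ≤ Q := by
    have : 0 ≤ L ^ (σ - 2) := by positivity
    linarith
  have hQ2 : L ^ (σ - 2) ≤ Q := by
    have : 0 ≤ (2 * L) ^ σ := by positivity
    linarith
  refine ⟨2 * (Q * C), by positivity, ?_⟩
  intro K v hK hv hva hvb hb0 hb2 N hN hN2 i hi hi2
  set x := node a b r N with hx
  set w : ℕ → ℝ := fun k => v (x k) with hw
  have hmono : StrictMonoOn x (Iic (2 * N)) := node_strictMonoOn hab hr hN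
  have hw0 : w 0 = 0 := by rw [hw, hx]; simp only [node_zero hr, hva]
  have hwn : w (2 * N) = 0 := by rw [hw, hx]; simp only [node_last hr hN, hvb]
  have hxi := node_mem_Ioo hab hr hN hi hi2
  rw [← hx] at hxi
  have hd1 : ∀ y ∈ Ioo a b, HasDerivAt v (deriv v y) y := fun y hy =>
    ((hv.differentiableOn (by norm_num)).differentiableAt (isOpen_Ioo.mem_nhds hy)).hasDerivAt
  have hd2 : ∀ y ∈ Ioo a b, HasDerivAt (deriv v) (iteratedDeriv 2 v y) y := fun y hy => by
    have h := hv.deriv_of_isOpen (m := 1) isOpen_Ioo (by norm_num)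
    have := ((h.differentiableOn (by norm_num)).differentiableAt
      (isOpen_Ioo.mem_nhds hy)).hasDerivAt
    rwa [iteratedDeriv_succ, iteratedDeriv_one]
  have w0 : ∀ z ∈ Ioc 0 L, (z * (2 * L - z)) ^ σ ≤ Q * z ^ σ := fun z hz => by
    rw [Real.mul_rpow hz.1.le (by linarith [hz.2]), mul_comm]
    have : (2 * L - z) ^ σ ≤ (2 * L) ^ σ :=
      Real.rpow_le_rpow (by linarith [hz.2]) (by linarith [hz.1]) hσ₀.le
    exact mul_le_mul_of_nonneg_right (this.trans hQ1) (Real.rpow_nonneg hz.1.le _)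
  have w2 : ∀ z ∈ Ioc 0 L, (z * (2 * L - z)) ^ (σ - 2) ≤ Q * z ^ (σ - 2) := fun z hz => by
    rw [Real.mul_rpow hz.1.le (by linarith [hz.2]), mul_comm]
    have : (2 * L - z) ^ (σ - 2) ≤ L ^ (σ - 2) :=
      Real.rpow_le_rpow_of_nonpos hL (by linarith [hz.2]) (by linarith)
    exact mul_le_mul_of_nonneg_right (this.trans hQ2) (Real.rpow_nonneg hz.1.le _)
  have hvB : ∀ y ∈ Icc a b, |v y| ≤ K * ((b - a) * (b - a)) ^ σ := by
    intro y hy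
    have hnn : 0 ≤ K * ((b - a) * (b - a)) ^ σ := mul_nonneg hK (Real.rpow_nonneg (by nlinarith) _)
    rcases eq_or_ne y a with rfl | hya
    · rw [hva, abs_zero]; exact hnn
    rcases eq_or_ne y b with rfl | hyb
    · rw [hvb, abs_zero]; exact hnn
    have hy' : y ∈ Ioo a b := ⟨lt_of_le_of_ne hy.1 hya.symm, lt_of_le_of_ne hy.2 hyb⟩
    refine (hb0 y hy').trans (mul_le_mul_of_nonneg_left (Real.rpow_le_rpow ?_ ?_ hσ₀.le) hK)
    · exact mul_nonneg (by linarith [hy.1]) (by linarith [hy.2])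
    · exact mul_le_mul (by linarith [hy.2]) (by linarith [hy.1]) (by linarith [hy.2]) (by linarith)
  set D : ℝ → ℝ := fun y => v y - interp x (2 * N) w y with hD
  have hint : IntervalIntegrable (fun y => D y * |x i - y| ^ (-α)) volume a b := by
    refine intervalIntegrable_mul_kernel
      (B := K * ((b - a) * (b - a)) ^ σ + K * ((b - a) * (b - a)) ^ σ) hα₁ _ hab.le
      ((aestronglyMeasurable_of_continuousOn_Ioo hv.continuousOn).sub
        (measurable_interp x (2 * N) w).aestronglyMeasurable) fun y hy => ?_
    have hy' : y ∈ Icc a b := ⟨hy.1.le, hy.2⟩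
    refine (abs_sub _ _).trans (add_le_add (hvB y hy') ?_)
    have hx0 : x 0 = a := node_zero hr
    have hxn : x (2 * N) = b := node_last hr hN
    refine abs_interp_le hmono (by omega) hw0 hwn (fun k hk => hvB _ ?_) (by rwa [hx0, hxn])
    constructor
    · rw [← hx0]; exact hmono.monotoneOn (mem_Iic.2 (Nat.zero_le _)) (mem_Iic.2 hk) (Nat.zero_le _)
    · rw [← hxn]; exact hmono.monotoneOn (mem_Iic.2 hk) (mem_Iic.2 le_rfl) hk
  have hbL : b - L = a + L := by rw [hLdef]; ring
  have haL : a + L ∈ Icc a b := ⟨by linarith, by rw [← hbL]; linarith⟩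
  have hintl : IntervalIntegrable (fun y => D y * |x i - y| ^ (-α)) volume a (a + L) :=
    hint.mono_set (by rw [uIcc_of_le haL.1, uIcc_of_le hab.le]; exact Icc_subset_Icc_right haL.2)
  have hintr : IntervalIntegrable (fun y => D y * |x i - y| ^ (-α)) volume (a + L) b :=
    hint.mono_set (by rw [uIcc_of_le haL.2, uIcc_of_le hab.le]; exact Icc_subset_Icc_left haL.1)
  have h2L : b - a = 2 * L := by rw [hLdef]; ring
  have left : |∫ y in a..(a + L), D y * |x i - y| ^ (-α)| ≤
      K * Q * C * spaceRate (r * (1 + σ - α)) N := by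
    have e : ∫ y in a..(a + L), D y * |x i - y| ^ (-α) =
        ∫ z in (0 : ℝ)..L, D (a + z) * |(x i - a) - z| ^ (-α) := by
      have := intervalIntegral.integral_comp_add_left (a := 0) (b := L)
        (fun y => D y * |x i - y| ^ (-α)) a
      rw [add_zero] at this
      rw [← this]
      simp only [sub_add_eq_sub_sub]
    have hI : IntervalIntegrable (fun z => D (a + z) * |(x i - a) - z| ^ (-α)) volume 0 L := by
      have := hintl.comp_add_left a
      simpa only [sub_add_eq_sub_sub, sub_self, add_sub_cancel_left] using this
    have hmem : ∀ z ∈ Ioc 0 L, a + z ∈ Ioo a b := fun z hz =>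
      ⟨by linarith [hz.1], by linarith [hz.2]⟩
    have hfac : ∀ z, (a + z - a) * (b - (a + z)) = z * (2 * L - z) := fun z => by
      rw [← h2L]; ring
    rw [e]
    refine hhalf (K * Q) (fun z => v (a + z)) (fun z => deriv v (a + z))
      (fun z => iteratedDeriv 2 v (a + z)) (fun z => D (a + z)) N (x i - a) (by positivity) hN hN2
      ⟨?_, by linarith [hxi.2]⟩ (by simpa using hva) ?_ ?_ ?_ ?_ ?_ hI
    · have h1 : x 1 ≤ x i := hmono.monotoneOn (mem_Iic.2 (by omega)) (mem_Iic.2 hi2.le) hi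
      rw [hx, node_of_le hN, ← hx] at h1
      linarith
    · intro z hz
      have := hb0 _ (hmem z hz)
      rw [hfac] at this
      rw [mul_assoc]
      exact this.trans (mul_le_mul_of_nonneg_left (w0 z hz) hK)
    · intro z hz
      exact (hd1 _ (hmem z hz)).comp_const_add a z
    · intro z hz
      exact (hd2 _ (hmem z hz)).comp_const_add a z
    · intro z hz
      have := hb2 _ (hmem z hz)
      rw [hfac] at this
      rw [mul_assoc]
      exact this.trans (mul_le_mul_of_nonneg_left (w2 z hz) hK)
    · intro j hj y hy
      have e1 : x j = a + gradedNode L r N j := node_of_le hj.le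
      have e2 : x (j + 1) = a + gradedNode L r N (j + 1) := node_of_le hj
      have := interp_eq_linInterp (y := a + y) hmono (by omega) hw0 hwn
        (show j < 2 * N by omega) (by rw [e1, e2]; exact ⟨by linarith [hy.1], by linarith [hy.2]⟩)
      simp only [hD]
      rw [this]
      simp only [hw]
      rw [e1, e2, linInterp_add_left]
  have right : |∫ y in (a + L)..b, D y * |x i - y| ^ (-α)| ≤
      K * Q * C * spaceRate (r * (1 + σ - α)) N := by
    have habs : ∀ z, |x i - (b - z)| = |(b - x i) - z| := fun z => by
      rw [← abs_neg]; congr 1; ring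
    have e : ∫ y in (a + L)..b, D y * |x i - y| ^ (-α) =
        ∫ z in (0 : ℝ)..L, D (b - z) * |(b - x i) - z| ^ (-α) := by
      have := intervalIntegral.integral_comp_sub_left (a := 0) (b := L)
        (fun y => D y * |x i - y| ^ (-α)) b
      rw [sub_zero, hbL] at this
      rw [← this]
      simp only [habs]
    have hI : IntervalIntegrable (fun z => D (b - z) * |(b - x i) - z| ^ (-α)) volume 0 L := by
      have := (hintr.comp_sub_left b).symm
      rw [sub_self, ← hbL, sub_sub_cancel] at this
      simpa only [habs] using this
    have hmem : ∀ z ∈ Ioc 0 L, b - z ∈ Ioo a b := fun z hz =>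
      ⟨by linarith [hz.2], by linarith [hz.1]⟩
    have hfac : ∀ z, (b - z - a) * (b - (b - z)) = z * (2 * L - z) := fun z => by
      rw [← h2L]; ring
    rw [e]
    refine hhalf (K * Q) (fun z => v (b - z)) (fun z => -deriv v (b - z))
      (fun z => iteratedDeriv 2 v (b - z)) (fun z => D (b - z)) N (b - x i) (by positivity) hN hN2
      ⟨?_, by linarith [hxi.1]⟩ (by simpa using hvb) ?_ ?_ ?_ ?_ ?_ hI
    · have h1 : x i ≤ x (2 * N - 1) :=
        hmono.monotoneOn (mem_Iic.2 hi2.le) (mem_Iic.2 (by omega)) (by omega)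
      have h2 : x (2 * N - 1) = b - gradedNode L r N 1 := by
        rw [hx, node_of_ge hN (by omega) (by omega), show 2 * N - (2 * N - 1) = 1 by omega]
      linarith
    · intro z hz
      have := hb0 _ (hmem z hz)
      rw [hfac] at this
      rw [mul_assoc]
      exact this.trans (mul_le_mul_of_nonneg_left (w0 z hz) hK)
    · intro z hz
      exact (hd1 _ (hmem z hz)).comp_const_sub b z
    · intro z hz
      exact ((hd2 _ (hmem z hz)).comp_const_sub b z).neg.congr_deriv (neg_neg _)
    · intro z hz
      have := hb2 _ (hmem z hz)
      rw [hfac] at this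
      rw [mul_assoc]
      exact this.trans (mul_le_mul_of_nonneg_left (w2 z hz) hK)
    · intro j hj y hy
      -- Reflection reverses the order of the cells: cell `j` of the half mesh is cell `2 * N - 1 -
      -- j` of the full mesh, with its ends exchanged.
      have e1 : x (2 * N - 1 - j) = b - gradedNode L r N (j + 1) := by
        rw [hx, node_of_ge hN (by omega) (by omega),
          show 2 * N - (2 * N - 1 - j) = j + 1 by omega]
      have e2 : x (2 * N - 1 - j + 1) = b - gradedNode L r N j := by
        rw [hx, node_of_ge hN (by omega) (by omega),
          show 2 * N - (2 * N - 1 - j + 1) = j by omega]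
      have := interp_eq_linInterp (y := b - y) hmono (by omega) hw0 hwn
        (show 2 * N - 1 - j < 2 * N by omega)
        (by rw [e1, e2]; exact ⟨by linarith [hy.2], by linarith [hy.1]⟩)
      simp only [hD]
      rw [this]
      simp only [hw]
      rw [e1, e2, linInterp_sub_left]
  rw [← intervalIntegral.integral_add_adjacent_intervals hintl hintr]
  refine (abs_add_le _ _).trans ((add_le_add left right).trans_eq ?_)
  ring

/-! ### The nonlocal operator and its discretisation -/

theorem nonlocalOp_eq (a b α : ℝ) (v : ℝ → ℝ) (x : ℝ) :
    nonlocalOp a b α v x = ∫ y in a..b, (v y - v x) * |x - y| ^ (-α) := by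
  simp only [nonlocalOp, div_abs_rpow_eq]

theorem intervalIntegrable_sub_const_mul_kernel {a b α B : ℝ} {v : ℝ → ℝ} (hab : a < b)
    (hα : α < 1) (hv : ContinuousOn v (Ioo a b)) (hB : ∀ y ∈ Icc a b, |v y| ≤ B) (c x : ℝ) :
    IntervalIntegrable (fun y => (v y - c) * |x - y| ^ (-α)) volume a b :=
  intervalIntegrable_mul_kernel (B := B + |c|) hα x hab.le
    ((aestronglyMeasurable_of_continuousOn_Ioo hv).sub aestronglyMeasurable_const)
    fun y hy => (abs_sub _ _).trans (add_le_add (hB y ⟨hy.1.le, hy.2⟩) le_rfl)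

/-- The nonlocal operator is bounded in the maximum norm; stated for a midpoint defect. -/
theorem abs_nonlocalOp_midpoint_le {a b α B δ x : ℝ} {v v₁ v₂ : ℝ → ℝ} (hab : a < b)
    (hα₀ : 0 < α) (hα : α < 1) (hx : x ∈ Icc a b) (hδ : 0 ≤ δ)
    (hv : ContinuousOn v (Ioo a b)) (hv₁ : ContinuousOn v₁ (Ioo a b))
    (hv₂ : ContinuousOn v₂ (Ioo a b)) (hB : ∀ y ∈ Icc a b, |v y| ≤ B)
    (hB₁ : ∀ y ∈ Icc a b, |v₁ y| ≤ B) (hB₂ : ∀ y ∈ Icc a b, |v₂ y| ≤ B)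
    (hd : ∀ y ∈ Icc a b, |v y - (v₁ y + v₂ y) / 2| ≤ δ) :
    |nonlocalOp a b α v x - (nonlocalOp a b α v₁ x + nonlocalOp a b α v₂ x) / 2| ≤
      2 * δ * (2 / (1 - α) * (b - a) ^ (1 - α)) := by
  have i0 := intervalIntegrable_sub_const_mul_kernel hab hα hv hB (v x) x
  have i1 := intervalIntegrable_sub_const_mul_kernel hab hα hv₁ hB₁ (v₁ x) x
  have i2 := intervalIntegrable_sub_const_mul_kernel hab hα hv₂ hB₂ (v₂ x) x
  have e : nonlocalOp a b α v x - (nonlocalOp a b α v₁ x + nonlocalOp a b α v₂ x) / 2 =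
      ∫ y in a..b, ((v y - (v₁ y + v₂ y) / 2) - (v x - (v₁ x + v₂ x) / 2)) * |x - y| ^ (-α) := by
    rw [nonlocalOp_eq, nonlocalOp_eq, nonlocalOp_eq, ← intervalIntegral.integral_add i1 i2,
      ← intervalIntegral.integral_div, ← intervalIntegral.integral_sub i0 ((i1.add i2).div_const 2)]
    congr 1
    ext y
    ring
  rw [e]
  refine abs_integral_mul_kernel_le hα₀ hα x hab.le (by positivity) fun y hy => ?_
  exact (abs_sub _ _).trans (by linarith [hd y ⟨hy.1.le, hy.2⟩, hd x hx])

/-- The collocation matrix applied to the nodal values of `v`, compared with the nonlocal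
operator. -/
theorem stiffness_mulVec_nodal {a b α r B : ℝ} {N : ℕ} {v : ℝ → ℝ} (hab : a < b) (hα : α < 1)
    (hr : 0 < r) (hN : 1 ≤ N) (hv : ContinuousOn v (Ioo a b)) (hB : ∀ y ∈ Icc a b, |v y| ≤ B)
    (hva : v a = 0) (hvb : v b = 0) (i : Fin (2 * N - 1)) :
    (stiffness a b α r N).mulVec (fun k => v (node a b r N (k + 1))) i =
      (∫ y in a..b, (v y - interp (node a b r N) (2 * N) (fun k => v (node a b r N k)) y) *
          |node a b r N (i + 1) - y| ^ (-α)) - nonlocalOp a b α v (node a b r N (i + 1)) := by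
  set x := node a b r N with hx
  have hmono : StrictMonoOn x (Iic (2 * N)) := node_strictMonoOn hab hr hN
  have hx0 : x 0 = a := node_zero hr
  have hxn : x (2 * N) = b := node_last hr hN
  have h := stiffness_mulVec (r := r) hab hα (fun k => v (x k)) i
  -- Exactness at `x_i` makes the values frozen at the collocation point cancel, leaving only the
  -- interpolation error under the integral.
  have hnode : interp x (2 * N) (fun k => v (x k)) (x (i + 1)) = v (x (i + 1)) :=
    interp_node hmono (by omega) (by omega)
  rw [← hx, hnode] at h
  have hP : ∀ y ∈ Icc a b, |interp x (2 * N) (fun k => v (x k)) y| ≤ B := fun y hy => by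
    refine abs_interp_le hmono (by omega) (by simp only [hx0, hva]) (by simp only [hxn, hvb])
      (fun k hk => hB _ ?_) (by rwa [hx0, hxn])
    constructor
    · rw [← hx0]; exact hmono.monotoneOn (mem_Iic.2 (Nat.zero_le _)) (mem_Iic.2 hk) (Nat.zero_le _)
    · rw [← hxn]; exact hmono.monotoneOn (mem_Iic.2 hk) (mem_Iic.2 le_rfl) hk
  have i1 : IntervalIntegrable (fun y => (v y - interp x (2 * N) (fun k => v (x k)) y) *
      |x (i + 1) - y| ^ (-α)) volume a b :=
    intervalIntegrable_mul_kernel (B := B + B) hα _ hab.le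
      ((aestronglyMeasurable_of_continuousOn_Ioo hv).sub
        (measurable_interp x (2 * N) _).aestronglyMeasurable) fun y hy =>
      (abs_sub _ _).trans (add_le_add (hB y ⟨hy.1.le, hy.2⟩) (hP y ⟨hy.1.le, hy.2⟩))
  have i2 := intervalIntegrable_sub_const_mul_kernel hab hα hv hB (v (x (i + 1))) (x (i + 1))
  rw [h, nonlocalOp_eq, ← intervalIntegral.integral_sub i1 i2]
  congr 1
  ext y
  ring

/-! ### Assembling the error bound -/

theorem exists_error_bound {a b α σ r : ℝ} (hab : a < b) (hα₀ : 0 < α) (hα₁ : α < 1)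
    (hσ₀ : 0 < σ) (hσ₁ : σ < 1) (hr : 0 < r) {u₀ : ℝ → ℝ} {f u : ℝ → ℝ → ℝ}
    (hsol : IsSolution a b α u₀ f u) (hspace : SpaceRegular a b σ u) (htime : TimeRegular a b u) :
    ∃ C : ℝ, 0 < C ∧ ∀ N M : ℕ, 1 ≤ N → 1 ≤ M → (r * (1 + σ - α) = 2 → 2 ≤ N) →
      ∀ U : ℕ → Fin (2 * N - 1) → ℝ, IsSchemeSolution a b α r u₀ f N M U →
      ∀ (i : Fin (2 * N - 1)) (k : ℕ), k ≤ M →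
        |u (node a b r N (i + 1)) ((k : ℝ) * (1 / (M : ℝ))) - U k i| ≤
          C * (spaceRate (r * (1 + σ - α)) N + (M : ℝ) ^ (-2 : ℝ)) := by
  obtain ⟨hC2, K, hK⟩ := hspace
  obtain ⟨hC3, K₃, hK₃⟩ := htime
  obtain ⟨Cs, hCs, htrunc⟩ := exists_bound_space_truncation hab hα₀ hα₁ hσ₀ hσ₁ hr
  set D := 2 / (1 - α) * (b - a) ^ (1 - α) with hD
  have hba : 0 < b - a := sub_pos.2 hab
  have h1α : 0 < 1 - α := by linarith
  have hD0 : 0 ≤ D := by positivity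
  have hmid : (a + b) / 2 ∈ Ioo a b := ⟨by linarith, by linarith⟩
  -- Nonnegativity of `K` is not assumed; it follows from the bound with `ℓ = 0` at the midpoint,
  -- where the weight is positive.
  have hK0 : 0 ≤ K := by
    by_contra hneg
    have h := (abs_nonneg _).trans (hK 0 (by norm_num) 0 ⟨le_rfl, zero_le_one⟩ _ hmid)
    have hp : 0 < (((a + b) / 2 - a) * (b - (a + b) / 2)) ^ (σ - ((0 : ℕ) : ℝ)) :=
      Real.rpow_pos_of_pos (mul_pos (by linarith) (by linarith)) _
    exact absurd h (not_le.2 (mul_neg_of_neg_of_pos (not_le.1 hneg) hp))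
  have hK3 : 0 ≤ K₃ := (abs_nonneg _).trans (hK₃ _ hmid 0 ⟨le_rfl, zero_le_one⟩)
  have hua : ∀ t ∈ Icc (0 : ℝ) 1, u a t = 0 := fun t ht =>
    hsol.exterior a (fun h => lt_irrefl _ h.1) t ht
  have hub : ∀ t ∈ Icc (0 : ℝ) 1, u b t = 0 := fun t ht =>
    hsol.exterior b (fun h => lt_irrefl _ h.2) t ht
  have hb0 : ∀ t ∈ Icc (0 : ℝ) 1, ∀ x ∈ Ioo a b, |u x t| ≤ K * ((x - a) * (b - x)) ^ σ :=
    fun t ht x hx => by simpa using hK 0 (by norm_num) t ht x hx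
  have hb2 : ∀ t ∈ Icc (0 : ℝ) 1, ∀ x ∈ Ioo a b,
      |iteratedDeriv 2 (fun y => u y t) x| ≤ K * ((x - a) * (b - x)) ^ (σ - 2) :=
    fun t ht x hx => by simpa using hK 2 le_rfl t ht x hx
  set B := K * ((b - a) * (b - a)) ^ σ with hB
  have hB0 : 0 ≤ B := by positivity
  have hends : ∀ P : ℝ → Prop, P a → P b → (∀ y ∈ Ioo a b, P y) → ∀ y ∈ Icc a b, P y := by
    intro P ha hb h y hy
    rcases eq_or_ne y a with rfl | hya
    · exact ha
    rcases eq_or_ne y b with rfl | hyb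
    · exact hb
    exact h y ⟨lt_of_le_of_ne hy.1 hya.symm, lt_of_le_of_ne hy.2 hyb⟩
  have huB : ∀ t ∈ Icc (0 : ℝ) 1, ∀ y ∈ Icc a b, |u y t| ≤ B := by
    intro t ht
    refine hends _ (by rw [hua t ht, abs_zero]; exact hB0) (by rw [hub t ht, abs_zero]; exact hB0)
      fun y hy => (hb0 t ht y hy).trans ?_
    refine mul_le_mul_of_nonneg_left (Real.rpow_le_rpow ?_ ?_ hσ₀.le) hK0
    · exact mul_nonneg (by linarith [hy.1]) (by linarith [hy.2])
    · exact mul_le_mul (by linarith [hy.2]) (by linarith [hy.1]) (by linarith [hy.2]) (by linarith)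
  set K₂ := 16 * B + 2 * K₃ with hK₂
  refine ⟨Real.exp D * (K * Cs + K₃ + K₂ * D + 1), by positivity, ?_⟩
  intro N M hN hM hN2 U hU i k hk
  obtain ⟨hU0, hUstep⟩ := hU
  set x := node a b r N with hx
  set A := stiffness a b α r N with hA
  have hM' : (0 : ℝ) < M := by positivity
  set τ := 1 / (M : ℝ) with hτ
  have hτ0 : 0 < τ := by positivity
  have hMτ : (M : ℝ) * τ = 1 := by rw [hτ]; field_simp
  set V : ℕ → Fin (2 * N - 1) → ℝ := fun j i => u (x (i + 1)) (j * τ) with hV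
  set F : ℕ → Fin (2 * N - 1) → ℝ := fun j => load a b r f N (((j : ℝ) - 1 / 2) * τ) with hF
  -- The residual of the exact nodal values in the scheme divided by `τ`, with `M` in place of
  -- `1/τ`; the error equation then holds by algebra.
  set R : ℕ → Fin (2 * N - 1) → ℝ := fun j =>
    (M : ℝ) • (V j - V (j - 1)) + (1 / 2 : ℝ) • (A.mulVec (V j) + A.mulVec (V (j - 1))) - F j with hR
  have hrate := spaceRate_nonneg (r * (1 + σ - α)) N
  set ρ := K * Cs * spaceRate (r * (1 + σ - α)) N + (K₃ + K₂ * D) * τ ^ 2 with hρ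
  have hxmem : ∀ i : Fin (2 * N - 1), x (i + 1) ∈ Ioo a b := fun i =>
    node_mem_Ioo hab hr hN (by omega) (by omega)
  have hoff : ∀ i k, i ≠ k → A i k ≤ 0 := fun i k hik =>
    coeff_nonpos hab hr hN (by omega) (by omega) (by omega)
      (fun h => hik (Fin.ext (by omega)))
  have hdiag : ∀ i, A i i ≤ D := fun i =>
    coeff_self_le hab hα₀ hα₁ hr hN (by omega) (by omega)
  have htrunc' : ∀ t ∈ Icc (0 : ℝ) 1, ∀ i : Fin (2 * N - 1),
      |A.mulVec (fun k => u (x (k + 1)) t) i + nonlocalOp a b α (fun y => u y t) (x (i + 1))| ≤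
        K * Cs * spaceRate (r * (1 + σ - α)) N := by
    intro t ht i
    have h := stiffness_mulVec_nodal (α := α) (r := r) (v := fun y => u y t) hab hα₁ hr hN
      (hC2 t ht).continuousOn (huB t ht) (hua t ht) (hub t ht) i
    rw [h, sub_add_cancel]
    exact htrunc K (fun y => u y t) hK0 (hC2 t ht) (hua t ht) (hub t ht) (hb0 t ht) (hb2 t ht)
      N hN hN2 _ (by omega) (by omega)
  have hRb : ∀ j : ℕ, 1 ≤ j → j ≤ M → ∀ i, |R j i| ≤ ρ := by
    intro j hj hjM i
    set t := ((j : ℝ) - 1 / 2) * τ with ht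
    have hj1 : (1 : ℝ) ≤ j := by exact_mod_cast hj
    have hjM' : (j : ℝ) ≤ M := by exact_mod_cast hjM
    have hcast : ((j - 1 : ℕ) : ℝ) = (j : ℝ) - 1 := by rw [Nat.cast_sub hj, Nat.cast_one]
    have hplus : t + τ / 2 = j * τ := by rw [ht]; ring
    have hminus : t - τ / 2 = ((j - 1 : ℕ) : ℝ) * τ := by rw [ht, hcast]; ring
    have hp1 : (j : ℝ) * τ ≤ 1 := by
      rw [← hMτ]; exact mul_le_mul_of_nonneg_right hjM' hτ0.le
    have hm0 : 0 ≤ ((j - 1 : ℕ) : ℝ) * τ := by positivity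
    -- The equation is available only for `0 < t < 1`, and it is used only at this midpoint, which
    -- is interior even in the first and last steps.
    have htIoo : t ∈ Ioo (0 : ℝ) 1 := ⟨by linarith, by linarith⟩
    have htI : t ∈ Icc (0 : ℝ) 1 := Ioo_subset_Icc_self htIoo
    have hpI : t + τ / 2 ∈ Icc (0 : ℝ) 1 := ⟨by linarith [htI.1], by linarith⟩
    have hmI : t - τ / 2 ∈ Icc (0 : ℝ) 1 := ⟨by linarith, by linarith [htI.2]⟩
    have hcd : ∀ y ∈ Ioo a b, _ := fun y hy => central_difference_bounds (hC3 y hy)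
      (fun s hs => huB s hs y (Ioo_subset_Icc_self hy)) (hK₃ y hy) htI (half_pos hτ0).le hmI hpI
    have hxi := hxmem i
    have hderiv : derivWithin (fun s => u (x (i + 1)) s) (Icc 0 1) t =
        nonlocalOp a b α (fun y => u y t) (x (i + 1)) + f (x (i + 1)) t :=
      (hsol.equation _ hxi t htIoo).hasDerivWithinAt.derivWithin (uniqueDiffOn_Icc zero_lt_one t htI)
    have c1 := (hcd _ hxi).1
    rw [hderiv] at c1
    have c1' : |(M : ℝ) * (u (x (i + 1)) (t + τ / 2) - u (x (i + 1)) (t - τ / 2)) -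
        (nonlocalOp a b α (fun y => u y t) (x (i + 1)) + f (x (i + 1)) t)| ≤ K₃ * τ ^ 2 := by
      have h := mul_le_mul_of_nonneg_left c1 hM'.le
      rw [← abs_of_pos hM', ← abs_mul, abs_of_pos hM'] at h
      have e1 : (M : ℝ) * (u (x (i + 1)) (t + τ / 2) - u (x (i + 1)) (t - τ / 2) -
          2 * (τ / 2) * (nonlocalOp a b α (fun y => u y t) (x (i + 1)) + f (x (i + 1)) t)) =
          (M : ℝ) * (u (x (i + 1)) (t + τ / 2) - u (x (i + 1)) (t - τ / 2)) -
          (M * τ) * (nonlocalOp a b α (fun y => u y t) (x (i + 1)) + f (x (i + 1)) t) := by ring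
      rw [e1, hMτ, one_mul] at h
      refine h.trans ?_
      have e2 : (M : ℝ) * (2 * K₃ * (τ / 2) ^ 3) = (M * τ) * (K₃ * τ ^ 2 / 4) := by ring
      rw [e2, hMτ, one_mul]
      have : 0 ≤ K₃ * τ ^ 2 := by positivity
      linarith
    -- The averaging defect in time is `O(τ²)` uniformly in space, and `𝓛` preserves this size; at
    -- the endpoints the defect is zero.
    have c2 := abs_nonlocalOp_midpoint_le (δ := K₂ * (τ / 2) ^ 2) (v := fun y => u y t)
      (v₁ := fun y => u y (t + τ / 2)) (v₂ := fun y => u y (t - τ / 2)) hab hα₀ hα₁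
      (Ioo_subset_Icc_self hxi) (by positivity) (hC2 _ htI).continuousOn (hC2 _ hpI).continuousOn
      (hC2 _ hmI).continuousOn (huB _ htI) (huB _ hpI) (huB _ hmI)
      (hends _ (by
          simp only [hua _ htI, hua _ hpI, hua _ hmI, add_zero, zero_div, sub_zero, abs_zero]
          positivity)
        (by
          simp only [hub _ htI, hub _ hpI, hub _ hmI, add_zero, zero_div, sub_zero, abs_zero]
          positivity)
        fun y hy => (hcd y hy).2)
    have c2' : 2 * (K₂ * (τ / 2) ^ 2) * (2 / (1 - α) * (b - a) ^ (1 - α)) ≤ K₂ * D * τ ^ 2 := by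
      rw [← hD]
      have : 0 ≤ K₂ * D * τ ^ 2 := by positivity
      linarith
    have c3 := htrunc' _ hpI i
    have c4 := htrunc' _ hmI i
    have hRj : R j i = (M : ℝ) * (u (x (i + 1)) (t + τ / 2) - u (x (i + 1)) (t - τ / 2)) +
        1 / 2 * (A.mulVec (fun k => u (x (k + 1)) (t + τ / 2)) i +
          A.mulVec (fun k => u (x (k + 1)) (t - τ / 2)) i) - f (x (i + 1)) t := by
      rw [hplus, hminus]
      rfl
    rw [hRj, hρ]
    have d1 := abs_le.1 c1'
    have d2 := abs_le.1 (c2.trans c2')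
    have d3 := abs_le.1 c3
    have d4 := abs_le.1 c4
    rw [abs_le]
    constructor <;> linarith [d1.1, d1.2, d2.1, d2.2, d3.1, d3.2, d4.1, d4.2]
  have hstab := crankNicolson_stable (A := A) (D := D) (ρ := ρ) (e := fun j => V j - U j) (R := R)
    hM hD0 (by positivity) hoff
    (fun i => stiffness_row_sum_nonneg hab hα₁ hr hN i) hdiag
    (fun i => by
      simp only [Pi.sub_apply, hV, hU0 i, Nat.cast_zero, zero_mul, hsol.initial _ (hxmem i), sub_self])
    (fun j hj hjM => by
      have h := hUstep j hj hjM
      rw [Matrix.mulVec_sub, h, Matrix.mulVec_sub]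
      ext i
      simp only [hR, hF, Matrix.add_mulVec, Matrix.sub_mulVec, Matrix.one_mulVec,
        Matrix.smul_mulVec, Pi.sub_apply, Pi.add_apply, Pi.smul_apply, smul_eq_mul]
      linear_combination (-(V j i) + V (j - 1) i) * hMτ)
    hRb k hk i
  refine hstab.trans ?_
  rw [mul_assoc]
  refine mul_le_mul_of_nonneg_left ?_ (Real.exp_pos D).le
  have hτ2 : τ ^ 2 = (M : ℝ) ^ (-2 : ℝ) := by
    rw [hτ, Real.rpow_neg hM'.le, Real.rpow_two, one_div, inv_pow]
  rw [hρ, ← hτ2]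
  have p1 : 0 ≤ K * Cs * τ ^ 2 := by positivity
  have p2 : 0 ≤ (K₃ + K₂ * D) * spaceRate (r * (1 + σ - α)) N := by positivity
  have p3 : 0 ≤ τ ^ 2 := by positivity
  linarith

end NonlocalCN

theorem theorem5p2 (a b α σ r : ℝ) (hab : a < b) (hα₀ : 0 < α) (hα₁ : α < 1)
    (hσ₀ : 0 < σ) (hσ₁ : σ < 1) (hr : 0 < r)
    (u₀ : ℝ → ℝ) (f u : ℝ → ℝ → ℝ)
    (hsol : NonlocalCN.IsSolution a b α u₀ f u)
    (hspace : NonlocalCN.SpaceRegular a b σ u)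
    (htime : NonlocalCN.TimeRegular a b u) :
    ∃ C : ℝ, 0 < C ∧ ∀ N M : ℕ, 1 ≤ N → 1 ≤ M → ∀ U : ℕ → Fin (2 * N - 1) → ℝ,
      NonlocalCN.IsSchemeSolution a b α r u₀ f N M U →
      ∀ (i : Fin (2 * N - 1)) (k : ℕ), 1 ≤ k → k ≤ M →
        (r * (1 + σ - α) < 2 →
          |u (NonlocalCN.node a b r N (i + 1)) ((k : ℝ) * (1 / (M : ℝ))) - U k i| ≤
            C * ((N : ℝ) ^ (-(r * (1 + σ - α))) + (M : ℝ) ^ (-2 : ℝ))) ∧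
        (r * (1 + σ - α) = 2 → 2 ≤ N →
          |u (NonlocalCN.node a b r N (i + 1)) ((k : ℝ) * (1 / (M : ℝ))) - U k i| ≤
            C * ((N : ℝ) ^ (-(r * (1 + σ - α))) * Real.log N + (M : ℝ) ^ (-2 : ℝ))) ∧
        (2 < r * (1 + σ - α) →
          |u (NonlocalCN.node a b r N (i + 1)) ((k : ℝ) * (1 / (M : ℝ))) - U k i| ≤
            C * ((N : ℝ) ^ (-2 : ℝ) + (M : ℝ) ^ (-2 : ℝ))) := by
  obtain ⟨C, hC, h⟩ :=
    NonlocalCN.exists_error_bound hab hα₀ hα₁ hσ₀ hσ₁ hr hsol hspace htime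
  refine ⟨C, hC, fun N M hN hM U hU i k _ hkM => ⟨fun hβ => ?_, fun hβ hN2 => ?_, fun hβ => ?_⟩⟩
  · simpa [NonlocalCN.spaceRate, hβ] using
      h N M hN hM (fun h2 => absurd h2 hβ.ne) U hU i k hkM
  · simpa [NonlocalCN.spaceRate, hβ] using h N M hN hM (fun _ => hN2) U hU i k hkM
  · simpa [NonlocalCN.spaceRate, hβ.not_gt, hβ.ne'] using
      h N M hN hM (fun h2 => absurd h2 hβ.ne') U hU i k hkM
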